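/- Let $G$ be a locally finite, weakly connected digraph (parallel edges allowed, no loops) with vertex set $V(G)$, edge set $E(G)$ and set of ends $\Omega(G)$, the ends being those of the underlying undirected multigraph, that is, the classes of rays under the relation "not separated by finitely many vertices". Let $|G|$ be the Freudenthal compactification of the underlying multigraph (viewed as a $1$-complex), so that $|G|$ consists of the vertices, the inner points of edges, and the ends. For a set $X$ of vertices let $\overline{X}$ be its closure in $|G|$; equivalently, $\overline X$ is the set $X$ together with all ends that contain a ray which cannot be separated from $X$ by finitely many vertices. For $F\subseteq E(G)$ let $\overline F$ be the closure in $|G|$ of the set of inner points of the edges in $F$. For distinct $s,t\in V(G)\cup\Omega(G)$, a directed $s$–$t$ arc is the image of a topological embedding $\sigma:[0,1]\to|G|$ with $\sigma(0)=s$ and $\sigma(1)=t$ that traverses every edge of which it contains an inner point in the direction of that edge. Let $r\in V(G)\cup\Omega(G)$, $Z\subseteq V(G)\setminus\{r\}$ and $F\subseteq E(G)$. Call $F$ $r$-reachable for $Z$ if, for every bipartition $(X,Y)$ of $V(G)$ with only finitely many edges between $X$ and $Y$ (in either direction), with $r\in\overline X$ and with $Y\cap Z\neq\emptyset$, the set $F$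 contains an edge with tail in $X$ and head in $Y$. Then $F$ is $r$-reachable for $Z$ if and only if for every point $z\in\overline Z$ with $z\neq r$ there is a directed $r$–$z$ arc contained in $\overline F$. -/

import Mathlib

universe u v

/-- A directed multigraph with vertex set `V` and edge set `E`: every edge has a tail and a head,
parallel edges are allowed, loops are not. -/
structure MultiDigraph (V : Type u) (E : Type v) where
  /-- The start vertex of an edge. -/
  tail : E → V
  /-- The target vertex of an edge. -/
  head : E → V
  tail_ne_head : ∀ e, tail e ≠ head e

namespace MultiDigraph

variable {V : Type u} {E : Type v} (G : MultiDigraph V E)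

/-- The adjacency relation of the underlying undirected multigraph, as a simple graph. -/
def underlying : SimpleGraph V where
  Adj a b := ∃ e, (G.tail e = a ∧ G.head e = b) ∨ (G.tail e = b ∧ G.head e = a)
  symm := ⟨fun _ _ ⟨e, he⟩ => ⟨e, he.symm⟩⟩
  loopless := ⟨by
    rintro a ⟨e, ⟨h1, h2⟩ | ⟨h1, h2⟩⟩ <;> exact G.tail_ne_head e (h1.trans h2.symm)⟩

/-- Every vertex is incident with only finitely many edges. -/
def LocallyFinite : Prop :=
  ∀ v : V, {e : E | G.tail e = v ∨ G.head e = v}.Finite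

/-- The underlying undirected multigraph is connected. -/
def WeaklyConnected : Prop := G.underlying.Connected

/-! ### Cuts -/

/-- `E(X, Y)`: all edges between `X` and `Y`, in either direction. -/
def edgesBetween (X Y : Set V) : Set E :=
  {e | (G.tail e ∈ X ∧ G.head e ∈ Y) ∨ (G.tail e ∈ Y ∧ G.head e ∈ X)}

/-- The edges with tail in `X` and head in `Y`. -/
def edgesFromTo (X Y : Set V) : Set E :=
  {e | G.tail e ∈ X ∧ G.head e ∈ Y}

/-! ### Rays and ends of the underlying multigraph -/

/-- `a` and `b` lie outside `S`, in the same component of the underlying graph minus `S`. -/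
def ConnectedOff (S : Set V) (a b : V) : Prop :=
  ∃ p : G.underlying.Walk a b, ∀ w ∈ p.support, w ∉ S

variable {G} in
theorem ConnectedOff.symm {S : Set V} {a b : V} (h : G.ConnectedOff S a b) :
    G.ConnectedOff S b a := by
  obtain ⟨p, hp⟩ := h
  exact ⟨p.reverse, fun w hw => hp w (by simpa using hw)⟩

variable {G} in
theorem ConnectedOff.trans {S : Set V} {a b c : V} (h : G.ConnectedOff S a b)
    (h' : G.ConnectedOff S b c) : G.ConnectedOff S a c := by
  obtain ⟨p, hp⟩ := h
  obtain ⟨q, hq⟩ := h'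
  refine ⟨p.append q, fun w hw => ?_⟩
  rcases (SimpleGraph.Walk.mem_support_append_iff p q).1 hw with h | h
  exacts [hp w h, hq w h]

variable {G} in
theorem ConnectedOff.mono {S T : Set V} (hST : S ⊆ T) {a b : V} (h : G.ConnectedOff T a b) :
    G.ConnectedOff S a b := by
  obtain ⟨p, hp⟩ := h
  exact ⟨p, fun w hw hwS => hp w hw (hST hwS)⟩

/-- A ray: a one-way infinite path, given by its sequence of vertices. (A choice among parallel
edges makes no difference to the end that contains the ray.) -/
structure Ray where
  /-- The `n`-th vertex of the ray. -/
  vert : ℕ → V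
  injective : Function.Injective vert
  adj : ∀ n, G.underlying.Adj (vert n) (vert (n + 1))

/-- Two rays are equivalent if no finite vertex set separates them: for every finite `S`, they
have tails in the same component of the graph minus `S`. -/
def RayEquiv (ρ ρ' : G.Ray) : Prop :=
  ∀ S : Set V, S.Finite → ∃ N, ∀ m ≥ N, ∀ n ≥ N, G.ConnectedOff S (ρ.vert m) (ρ'.vert n)

theorem rayEquiv_refl (ρ : G.Ray) : G.RayEquiv ρ ρ := by
  intro S hS
  have hfin : (ρ.vert ⁻¹' S).Finite := hS.preimage ρ.injective.injOn
  obtain ⟨N, hN⟩ := hfin.bddAbove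
  have hout : ∀ n ≥ N + 1, ρ.vert n ∉ S := fun n hn hnS => by
    have := hN (show n ∈ ρ.vert ⁻¹' S from hnS)
    omega
  have hbase : ∀ n ≥ N + 1, G.ConnectedOff S (ρ.vert (N + 1)) (ρ.vert n) := by
    intro n hn
    induction n, hn using Nat.le_induction with
    | base => exact ⟨SimpleGraph.Walk.nil, fun w hw => by
        simp only [SimpleGraph.Walk.support_nil, List.mem_singleton] at hw
        exact hw ▸ hout _ le_rfl⟩
    | succ k hk ih =>
      refine ih.trans ⟨SimpleGraph.Walk.cons (ρ.adj k) SimpleGraph.Walk.nil, fun w hw => ?_⟩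
      simp only [SimpleGraph.Walk.support_cons, SimpleGraph.Walk.support_nil, List.mem_cons,
        List.not_mem_nil, or_false] at hw
      rcases hw with rfl | rfl
      exacts [hout _ hk, hout _ (by omega)]
  exact ⟨N + 1, fun m hm n hn => (hbase m hm).symm.trans (hbase n hn)⟩

/-- Equivalence of rays. -/
def raySetoid : Setoid G.Ray where
  r := G.RayEquiv
  iseqv :=
    { refl := G.rayEquiv_refl
      symm := fun h S hS => by
        obtain ⟨N, hN⟩ := h S hS
        exact ⟨N, fun m hm n hn => (hN n hn m hm).symm⟩
      trans := fun h h' S hS => by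
        obtain ⟨N, hN⟩ := h S hS
        obtain ⟨N', hN'⟩ := h' S hS
        exact ⟨max N N', fun m hm n hn =>
          (hN m (le_trans (le_max_left _ _) hm) (max N N') (le_max_left _ _)).trans
            (hN' (max N N') (le_max_right _ _) n (le_trans (le_max_right _ _) hn))⟩ }

/-- The ends of `G`: equivalence classes of rays of the underlying multigraph. -/
def Ends : Type u := Quotient G.raySetoid

variable {G} in
/-- The end that contains a given ray. -/
def Ray.toEnd (ρ : G.Ray) : G.Ends := Quotient.mk G.raySetoid ρ

/-- `C(S, ω)`, for a finite vertex set `S`: the vertex set of the component of the graph minus `S`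
in which the rays of `ω` have tails. -/
def endComponent (S : Set V) (ω : G.Ends) : Set V :=
  {v | ∃ ρ : G.Ray, ρ.toEnd = ω ∧ ∃ N, ∀ n ≥ N, G.ConnectedOff S (ρ.vert n) v}

theorem endComponent_anti {S T : Set V} (hST : S ⊆ T) (ω : G.Ends) :
    G.endComponent T ω ⊆ G.endComponent S ω := by
  rintro v ⟨ρ, hρ, N, hN⟩
  exact ⟨ρ, hρ, N, fun n hn => (hN n hn).mono hST⟩

/-! ### The Freudenthal compactification -/

/-- The points of `|G|`: vertices, inner points of edges, and ends. The point `inner e t` is the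
point at parameter `t` on the edge `e`, parametrised from its tail to its head. -/
inductive Space : Type (max u v)
  | vertex (x : V) : Space
  | inner (e : E) (t : Set.Ioo (0 : ℝ) 1) : Space
  | endPt (ω : G.Ends) : Space

/-- The basic neighbourhood of an end `ω` given by a finite vertex set `S`: the component
`C(S, ω)`, the ends that have a ray in it, and the inner points of all edges with at least one
endvertex in it (that is, of all edges inside `C(S, ω)` or between `S` and `C(S, ω)`). -/
def endNhd (S : Set V) (ω : G.Ends) : Set G.Space :=
  {p | match p with
    | .vertex x => x ∈ G.endComponent S ω
    | .inner e _ => G.tail e ∈ G.endComponent S ω ∨ G.head e ∈ G.endComponent S ω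
    | .endPt ω' => ∃ ρ : G.Ray, ρ.toEnd = ω' ∧ ∀ n, ρ.vert n ∈ G.endComponent S ω}

theorem endNhd_anti {S T : Set V} (hST : S ⊆ T) (ω : G.Ends) :
    G.endNhd T ω ⊆ G.endNhd S ω := by
  have h := G.endComponent_anti hST ω
  rintro (x | ⟨e, t⟩ | ω') hp
  · exact h hp
  · exact hp.imp (fun h' => h h') (fun h' => h h')
  · obtain ⟨ρ, hρ, h'⟩ := hp
    exact ⟨ρ, hρ, fun n => h (h' n)⟩

/-- The topology of `|G|`. A set is open if it is open in every edge, contains with every vertex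
a short initial or final part of each edge at that vertex, and contains with every end one of the
basic neighbourhoods of that end. -/
instance : TopologicalSpace G.Space where
  IsOpen U :=
    (∀ e, IsOpen {t | Space.inner e t ∈ U}) ∧
    (∀ x, Space.vertex x ∈ U → ∃ ε : ℝ, 0 < ε ∧ ∀ (e : E) (t : Set.Ioo (0 : ℝ) 1),
      (G.tail e = x → (t : ℝ) < ε → Space.inner e t ∈ U) ∧
      (G.head e = x → 1 - ε < (t : ℝ) → Space.inner e t ∈ U)) ∧
    (∀ ω, Space.endPt ω ∈ U → ∃ S : Set V, S.Finite ∧ G.endNhd S ω ⊆ U)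
  isOpen_univ :=
    ⟨fun _ => by simp, fun _ _ => ⟨1, one_pos, by simp⟩,
      fun _ _ => ⟨∅, Set.finite_empty, Set.subset_univ _⟩⟩
  isOpen_inter := by
    rintro U U' ⟨hE, hV, hΩ⟩ ⟨hE', hV', hΩ'⟩
    refine ⟨fun e => (hE e).inter (hE' e), fun x hx => ?_, fun ω hω => ?_⟩
    · obtain ⟨ε, hε, h⟩ := hV x hx.1
      obtain ⟨ε', hε', h'⟩ := hV' x hx.2
      refine ⟨min ε ε', lt_min hε hε', fun e t => ⟨fun hx ht => ⟨?_, ?_⟩, fun hx ht => ⟨?_, ?_⟩⟩⟩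
      · exact (h e t).1 hx (ht.trans_le (min_le_left _ _))
      · exact (h' e t).1 hx (ht.trans_le (min_le_right _ _))
      · exact (h e t).2 hx (by linarith [min_le_left ε ε'])
      · exact (h' e t).2 hx (by linarith [min_le_right ε ε'])
    · obtain ⟨S, hS, h⟩ := hΩ ω hω.1
      obtain ⟨S', hS', h'⟩ := hΩ' ω hω.2
      exact ⟨S ∪ S', hS.union hS', Set.subset_inter
        ((G.endNhd_anti Set.subset_union_left ω).trans h)
        ((G.endNhd_anti Set.subset_union_right ω).trans h')⟩
  isOpen_sUnion := by
    intro 𝒰 h𝒰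
    refine ⟨fun e => ?_, fun x hx => ?_, fun ω hω => ?_⟩
    · have : {t | Space.inner e t ∈ ⋃₀ 𝒰} = ⋃ U ∈ 𝒰, {t | (Space.inner e t : G.Space) ∈ U} := by
        ext t; simp
      rw [this]
      exact isOpen_biUnion fun U hU => (h𝒰 U hU).1 e
    · obtain ⟨U, hU, hxU⟩ := hx
      obtain ⟨ε, hε, h⟩ := (h𝒰 U hU).2.1 x hxU
      exact ⟨ε, hε, fun e t => ⟨fun h1 h2 => ⟨U, hU, (h e t).1 h1 h2⟩,
        fun h1 h2 => ⟨U, hU, (h e t).2 h1 h2⟩⟩⟩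
    · obtain ⟨U, hU, hωU⟩ := hω
      obtain ⟨S, hS, h⟩ := (h𝒰 U hU).2.2 ω hωU
      exact ⟨S, hS, h.trans (Set.subset_sUnion_of_mem hU)⟩

/-- `V(G) ∪ Ω(G)`, as a set of points of `|G|`. -/
def verticesAndEnds : Set G.Space :=
  Set.range Space.vertex ∪ Set.range Space.endPt

/-- The set of inner points of an edge. -/
def edgeInterior (e : E) : Set G.Space := Set.range (Space.inner e)

/-- The closure in `|G|` of an edge set. -/
def edgeClosure (F : Set E) : Set G.Space := closure (⋃ e ∈ F, G.edgeInterior e)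

/-- The closure in `|G|` of a vertex set. -/
def vertexClosure (Z : Set V) : Set G.Space := closure (Space.vertex '' Z)

/-- The combinatorial closure of a vertex set `X`: the vertices in `X`, together with all ends that
contain a ray which cannot be separated from `X` by finitely many vertices. -/
def combClosure (X : Set V) : Set G.Space :=
  Space.vertex '' X ∪
    Space.endPt '' {ω | ∃ ρ : G.Ray, ρ.toEnd = ω ∧
      ∀ S : Set V, S.Finite → ∃ n, ∃ x ∈ X, G.ConnectedOff S (ρ.vert n) x}

/-! ### Directed arcs -/

/-- The order of the inner points of an edge `e` that is induced by the direction of `e`. -/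
def edgeLT (e : E) (p q : G.Space) : Prop :=
  ∃ s t : Set.Ioo (0 : ℝ) 1, p = Space.inner e s ∧ q = Space.inner e t ∧ s < t

/-- `A` is a directed `s`--`t` arc: it is the image of an embedding `σ` of the unit interval that
starts in `s`, ends in `t`, and traverses every edge of which `A` contains an inner point in the
direction of that edge, that is, the order of the inner points of this edge along `σ` is the one
induced by the direction of the edge. -/
def IsDirectedArc (A : Set G.Space) (s t : G.Space) : Prop :=
  ∃ σ : unitInterval → G.Space, Topology.IsEmbedding σ ∧ Set.range σ = A ∧ σ 0 = s ∧ σ 1 = t ∧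
    ∀ e, (G.edgeInterior e ∩ A).Nonempty →
      ∀ p ∈ G.edgeInterior e, ∀ q ∈ G.edgeInterior e,
        (G.edgeLT e p q ↔ ∃ a b : unitInterval, σ a = p ∧ σ b = q ∧ a < b)

/-! ### Reachability -/

/-- `F` is `r`-reachable for `Z`: it contains an edge from `X` to `Y` for every finite cut
`E(X, Y)` such that `r` lies in the combinatorial closure of `X`, and `Y` meets `Z`. -/
def IsReachable (r : G.Space) (Z : Set V) (F : Set E) : Prop :=
  ∀ X Y : Set V, IsCompl X Y → (G.edgesBetween X Y).Finite → r ∈ G.combClosure X →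
    (Y ∩ Z).Nonempty → (F ∩ G.edgesFromTo X Y).Nonempty

end MultiDigraph

/-! Arcs force crossing edges. Compose a directed arc from `r` to a vertex of `Z` in `Y` with the
continuous function `cutFun X`. After its last zero it takes the value 1/2, necessarily inside a
crossing edge, and an edge entering `X` would carry the arc back towards 0
(`IsDirectedArc.exists_leaves`).

For the existence of arcs, vertices and ends are encoded as ultrafilters on `V`, and reachability
yields `Connects`. As the cuts are finite, Zorn's lemma gives a minimal connecting set `F`. Each `e
∈ F` has a tight set `C e`: a separating set left by `e` alone among the edges of `F`. Uncrossing
tight sets shows that `F` never enters one and that they order `F` linearly.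

The closure of this minimal `F` is itself the arc. The functions `cutFun (C e)` are monotone along
the order (`cutFun_tight_total`) and distinguish the points of the closure
(`LocallyFinite.eq_of_cutFun_tight_eq`, resting on `Touches.mem_of_mem`). Their sum with positive
weights of total 1 is therefore a continuous injection of the closure into [0,1]. The edges of `F`
are mapped onto disjoint intervals of total length 1, so the compact image has no gap. Since `|G|`
is compact, the inverse is an embedding of [0,1]. -/

namespace MultiDigraph
-- Finite cuts, minimal connecting edge sets and uncrossing.
section Combinatorics

variable {V : Type u} {E : Type v} {G : MultiDigraph V E}

variable (G) in
/-- The set `X` has a finite edge boundary. -/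
def FiniteCut (X : Set V) : Prop := (G.edgesBetween X Xᶜ).Finite

/-- An edge crossing `W` must cross `X` or `Y`. All Boolean closure properties of finite cuts follow
from this. -/
theorem FiniteCut.of_cover {X Y W : Set V} (hX : G.FiniteCut X) (hY : G.FiniteCut Y)
    (h : ∀ a b : V, (a ∈ X ↔ b ∈ X) → (a ∈ Y ↔ b ∈ Y) → (a ∈ W ↔ b ∈ W)) : G.FiniteCut W := by
  refine (Set.Finite.union hX hY).subset fun e he => ?_
  by_contra hcon
  simp only [edgesBetween, Set.mem_union, Set.mem_ofPred_eq, Set.mem_compl_iff] at he hcon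
  have := h (G.tail e) (G.head e) (by tauto) (by tauto)
  tauto

theorem FiniteCut.compl {X : Set V} (hX : G.FiniteCut X) : G.FiniteCut Xᶜ :=
  hX.of_cover hX fun _ _ h _ => not_congr h

theorem FiniteCut.inter {X Y : Set V} (hX : G.FiniteCut X) (hY : G.FiniteCut Y) :
    G.FiniteCut (X ∩ Y) :=
  hX.of_cover hY fun _ _ h h' => and_congr h h'

theorem FiniteCut.union {X Y : Set V} (hX : G.FiniteCut X) (hY : G.FiniteCut Y) :
    G.FiniteCut (X ∪ Y) :=
  hX.of_cover hY fun _ _ h h' => or_congr h h'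

theorem FiniteCut.diff {X Y : Set V} (hX : G.FiniteCut X) (hY : G.FiniteCut Y) :
    G.FiniteCut (X \ Y) :=
  hX.inter hY.compl

theorem finiteCut_univ : G.FiniteCut Set.univ := by
  simp [FiniteCut, edgesBetween]

theorem finiteCut_empty : G.FiniteCut ∅ := by
  simp [FiniteCut, edgesBetween]

variable (G) in
/-- The edge `e` leaves the vertex set `X`. -/
def Leaves (e : E) (X : Set V) : Prop := G.tail e ∈ X ∧ G.head e ∉ X

variable (G) in
/-- `X` has a finite edge boundary and separates the ultrafilter `R` from the ultrafilter `Q`. -/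
structure Separates (R Q : Ultrafilter V) (X : Set V) : Prop where
  finiteCut : G.FiniteCut X
  mem : X ∈ R
  notMem : X ∉ Q

variable {R Q : Ultrafilter V}

theorem Separates.inter {X Y : Set V} (hX : G.Separates R Q X) (hY : G.Separates R Q Y) :
    G.Separates R Q (X ∩ Y) :=
  ⟨hX.1.inter hY.1, Filter.inter_mem hX.2 hY.2,
    fun h => hX.3 (Filter.mem_of_superset h Set.inter_subset_left)⟩

theorem Separates.union {X Y : Set V} (hX : G.Separates R Q X) (hY : G.FiniteCut Y)
    (hYQ : Y ∉ Q) : G.Separates R Q (X ∪ Y) :=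
  ⟨hX.1.union hY, Filter.mem_of_superset hX.2 Set.subset_union_left,
    fun h => (Ultrafilter.union_mem_iff.1 h).elim hX.3 hYQ⟩

variable (G) in
/-- Every finite cut that separates `R` from `Q` is left by an edge in `F`. -/
def Connects (R Q : Ultrafilter V) (F : Set E) : Prop :=
  ∀ X, G.Separates R Q X → ∃ e ∈ F, G.Leaves e X

/-- Zorn's lemma applies because cuts are finite: if the intersection of a chain misses all edges
leaving `X`, so does a single member of the chain. -/
theorem Connects.exists_minimal {F : Set E} (hF : G.Connects R Q F) :
    ∃ F' ⊆ F, Minimal (G.Connects R Q) F' := by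
  refine zorn_superset_nonempty {F | G.Connects R Q F} (fun c hc hchain hne => ?_) F hF
  refine ⟨⋂₀ c, fun X hX => ?_, fun s hs => Set.sInter_subset_of_mem hs⟩
  by_contra! hcon
  have hfin : {e | G.Leaves e X}.Finite :=
    hX.finiteCut.subset fun e he => Or.inl ⟨he.1, he.2⟩
  have hex : ∀ e, G.Leaves e X → ∃ s ∈ c, e ∉ s := by
    intro e he
    by_contra! h
    exact hcon e (Set.mem_sInter.2 h) he
  have key : ∀ B : Set E, B.Finite → B ⊆ {e | G.Leaves e X} → ∃ s ∈ c, ∀ e ∈ B, e ∉ s := by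
    intro B hB
    induction B, hB using Set.Finite.induction_on with
    | empty => exact fun _ => ⟨_, hne.some_mem, by simp⟩
    | insert _ _ ih =>
      intro hsub
      obtain ⟨s, hs, h1⟩ := ih ((Set.subset_insert _ _).trans hsub)
      obtain ⟨t, ht, h2⟩ := hex _ (hsub (Set.mem_insert _ _))
      rcases hchain.total hs ht with h | h
      · refine ⟨s, hs, fun e he => ?_⟩
        rcases he with rfl | he
        exacts [fun h' => h2 (h h'), h1 e he]
      · refine ⟨t, ht, fun e he => ?_⟩
        rcases he with rfl | he
        exacts [h2, fun h' => h1 e he (h h')]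
  obtain ⟨s, hs, h⟩ := key _ hfin subset_rfl
  obtain ⟨e, he, he'⟩ := hc hs X hX
  exact h e he' he

variable (G) in
/-- `X` separates `R` from `Q`, and `e` is the only edge in `F` that leaves `X`. -/
structure Tight (R Q : Ultrafilter V) (F : Set E) (X : Set V) (e : E) : Prop where
  separates : G.Separates R Q X
  leaves_iff : ∀ f ∈ F, G.Leaves f X ↔ f = e

variable {F : Set E}

/-- Deleting `e` breaks connection, so some separating set is left by no other edge of `F`; it must
be left by `e`. -/
theorem exists_tight (hF : Minimal (G.Connects R Q) F) {e : E} (he : e ∈ F) :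
    ∃ X, G.Tight R Q F X e := by
  by_contra! hcon
  have : G.Connects R Q (F \ {e}) := by
    intro X hX
    by_contra! h
    refine hcon X ⟨hX, fun f hf => ⟨fun hl => ?_, ?_⟩⟩
    · by_contra hne
      exact h f ⟨hf, hne⟩ hl
    · rintro rfl
      obtain ⟨g, hg, hl⟩ := hF.1 X hX
      by_cases hgf : g = f
      exacts [hgf ▸ hl, (h g ⟨hg, hgf⟩ hl).elim]
  exact (hF.2 this Set.sdiff_subset he).2 rfl

variable {X Y : Set V} {e f : E}

theorem Tight.mem (h : G.Tight R Q F X e) (hF : G.Connects R Q F) : e ∈ F := by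
  obtain ⟨g, hg, hl⟩ := hF X h.separates
  exact (h.leaves_iff g hg).1 hl ▸ hg

theorem Tight.leaves (h : G.Tight R Q F X e) (hF : G.Connects R Q F) : G.Leaves e X :=
  (h.leaves_iff e (h.mem hF)).2 rfl

/-- Intersections of tight sets are tight. -/
theorem Tight.inter (hF : G.Connects R Q F) (hX : G.Tight R Q F X e) (hY : G.Tight R Q F Y f) :
    ∃ g, G.Tight R Q F (X ∩ Y) g := by
  have hs := hX.separates.inter hY.separates
  -- An edge of `F` leaving the intersection or the union leaves `X` or `Y`, so it is `e` or `f`. If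
  -- distinct `e` and `f` both left the intersection, `k` would have its tail in both sets and its
  -- head in neither, so it would leave both, forcing `e = f`.
  obtain ⟨g, hg, hgl⟩ := hF _ hs
  obtain ⟨k, hk, hkl⟩ := hF _ (hX.separates.union hY.separates.1 hY.separates.3)
  refine ⟨g, hs, fun a ha => ⟨fun hal => ?_, fun h => h ▸ hgl⟩⟩
  have h1 := hX.leaves_iff
  have h2 := hY.leaves_iff
  simp only [Leaves, Set.mem_inter_iff, Set.mem_union] at *
  grind

/-- No edge of a minimal connecting set enters a tight set. -/
theorem Tight.tail_mem (hF : Minimal (G.Connects R Q) F) (hX : G.Tight R Q F X e) (hf : f ∈ F)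
    (hh : G.head f ∈ X) : G.tail f ∈ X := by
  by_contra ht
  obtain ⟨Y, hY⟩ := exists_tight hF hf
  -- Here `f` runs from `Y \ X` to `X \ Y`, so it leaves neither the intersection nor the union.
  -- Hence `e` leaves both, so it leaves `Y` and equals `f`, although `f` does not leave `X`.
  obtain ⟨g, hg, hgl⟩ := hF.1 _ (hX.separates.inter hY.separates)
  obtain ⟨k, hk, hkl⟩ := hF.1 _ (hX.separates.union hY.separates.1 hY.separates.3)
  have h1 := hX.leaves_iff
  have h2 := hY.leaves_iff
  simp only [Leaves, Set.mem_inter_iff, Set.mem_union] at *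
  grind

theorem Tight.tail_mem_iff (hF : Minimal (G.Connects R Q) F) (hX : G.Tight R Q F X e)
    (hf : f ∈ F) (hfe : f ≠ e) : G.tail f ∈ X ↔ G.head f ∈ X := by
  refine ⟨fun ht => ?_, hX.tail_mem hF hf⟩
  by_contra hh
  exact hfe ((hX.leaves_iff f hf).1 ⟨ht, hh⟩)

/-- Of two edges of a minimal connecting set, exactly one comes before the other. -/
theorem Tight.tail_mem_iff_tail_notMem (hF : Minimal (G.Connects R Q) F)
    (hX : G.Tight R Q F X e) (hY : G.Tight R Q F Y f) (hef : e ≠ f) :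
    G.tail e ∈ Y ↔ G.tail f ∉ X := by
  have he := hX.mem hF.1
  have hf := hY.mem hF.1
  have h3 := hY.tail_mem_iff hF he hef
  have h4 := hX.tail_mem_iff hF hf hef.symm
  -- The edge leaving `X ∩ Y` gives at least one of `tail e ∈ Y`, `tail f ∈ X`; the edge leaving `X
  -- ∪ Y` excludes one of them.
  obtain ⟨g, hg, hgl⟩ := hF.1 _ (hX.separates.inter hY.separates)
  obtain ⟨k, hk, hkl⟩ := hF.1 _ (hX.separates.union hY.separates.1 hY.separates.3)
  have h1 := hX.leaves_iff
  have h2 := hY.leaves_iff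
  simp only [Leaves, Set.mem_inter_iff, Set.mem_union] at *
  grind

/-- The order of the edges of a minimal connecting set is respected by every tight set. -/
theorem Tight.tail_mem_of_tail_mem (hF : Minimal (G.Connects R Q) F) {W : Set V} {g : E}
    (hX : G.Tight R Q F X e) (hY : G.Tight R Q F Y f) (hW : G.Tight R Q F W g) (hef : e ≠ f)
    (hlt : G.tail e ∈ Y) (hfW : G.tail f ∈ W) : G.tail e ∈ W := by
  -- `Y ∩ W` is again tight for `f`. The equivalent condition `tail f ∉ X` does not depend on the
  -- set chosen for `f`, so it transfers from `Y` to `Y ∩ W`.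
  obtain ⟨k, hk⟩ := hY.inter hF.1 hW
  have hfl := hY.leaves hF.1
  have : f = k := (hk.leaves_iff f (hY.mem hF.1)).1 ⟨⟨hfl.1, hfW⟩, fun h => hfl.2 h.1⟩
  subst this
  exact ((hX.tail_mem_iff_tail_notMem hF hk hef).2
    ((hX.tail_mem_iff_tail_notMem hF hY hef).1 hlt)).2

variable (G) in
/-- Every set with finite boundary in the ultrafilter `P` contains an endvertex of an edge
in `F`. -/
def Touches (F : Set E) (P : Ultrafilter V) : Prop :=
  ∀ N, G.FiniteCut N → N ∈ P → ∃ e ∈ F, G.tail e ∈ N ∨ G.head e ∈ N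

/-- A separating set may be shrunk to its intersection with `N`; dually, on the side of `Q`, it may
be enlarged by `Nᶜ`. -/
theorem Connects.touches_left (hF : G.Connects R Q F) (hX : G.Separates R Q X) :
    G.Touches F R := by
  intro N hN hNR
  obtain ⟨e, he, hl⟩ := hF (X ∩ N) ⟨hX.1.inter hN, Filter.inter_mem hX.2 hNR,
    fun h => hX.3 (Filter.mem_of_superset h Set.inter_subset_left)⟩
  exact ⟨e, he, Or.inl hl.1.2⟩

theorem Connects.touches_right (hF : G.Connects R Q F) (hX : G.Separates R Q X) :
    G.Touches F Q := by
  intro N hN hNQ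
  obtain ⟨e, he, hl⟩ := hF (X ∪ Nᶜ) (hX.union hN.compl (Ultrafilter.compl_notMem_iff.2 hNQ))
  exact ⟨e, he, Or.inr (by_contra fun h => hl.2 (Or.inr h))⟩

/-- `N` need not lie in `R`. If no edge left `N`, an edge `e` touching `N` would have its head
there; adding `N` to a tight set of `e` would give a separating set that no edge of `F` can leave.
-/
theorem Touches.exists_leaves (hF : Minimal (G.Connects R Q) F) {P : Ultrafilter V}
    (hP : G.Touches F P) {N : Set V} (hN : G.FiniteCut N) (hNP : N ∈ P) (hNQ : N ∉ Q) :
    ∃ e ∈ F, G.Leaves e N := by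
  by_contra! hcon
  obtain ⟨e, he, ht⟩ := hP N hN hNP
  have hh : G.head e ∈ N := by
    by_contra h
    exact hcon e he ⟨ht.resolve_right h, h⟩
  obtain ⟨X, hX⟩ := exists_tight hF he
  obtain ⟨g, hg, hl⟩ := hF.1 _ (hX.separates.union hN hNQ)
  have hgN : G.tail g ∉ N := fun h => hcon g hg ⟨h, fun h' => hl.2 (Or.inr h')⟩
  have : g = e := (hX.leaves_iff g hg).1
    ⟨hl.1.resolve_right hgN, fun h' => hl.2 (Or.inl h')⟩
  exact hl.2 (Or.inr (this ▸ hh))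

theorem finite_biInter_tight (hF : Minimal (G.Connects R Q) F) (C : E → Set V)
    (hC : ∀ e ∈ F, G.Tight R Q F (C e) e) {D : Set E} (hD : D.Finite) (hDF : D ⊆ F) :
    (⋂ e ∈ D, C e) = Set.univ ∨ ∃ g, G.Tight R Q F (⋂ e ∈ D, C e) g := by
  induction D, hD using Set.Finite.induction_on with
  | empty => simp
  | @insert a s _ _ ih =>
    right
    rw [Set.biInter_insert]
    have ha := hC a (hDF (Set.mem_insert _ _))
    rcases ih ((Set.subset_insert _ _).trans hDF) with h | ⟨g, hg⟩
    · exact ⟨a, by rwa [h, Set.inter_univ]⟩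
    · exact ha.inter hF.1 hg

/-- Finite cuts separating two ultrafilters touched by a minimal connecting set can be replaced
by tight ones. -/
theorem Touches.mem_of_mem (hF : Minimal (G.Connects R Q) F) (C : E → Set V)
    (hC : ∀ e ∈ F, G.Tight R Q F (C e) e) {P P' : Ultrafilter V}
    (hP : G.Touches F P) (hP' : G.Touches F P') (h : ∀ e ∈ F, C e ∈ P ↔ C e ∈ P')
    (hX : G.FiniteCut X) (hXP : X ∈ P) : X ∈ P' := by
  by_contra hXP'
  set D : Set E := {e | e ∈ F ∧ e ∈ G.edgesBetween X Xᶜ} with hDdef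
  have hD : D.Finite := Set.Finite.subset hX fun e he => he.2
  set D₁ : Set E := {e | e ∈ D ∧ C e ∉ P} with hD₁def
  set D₂ : Set E := {e | e ∈ D ∧ C e ∈ P} with hD₂def
  have hD₁ : D₁.Finite := hD.subset fun e he => he.1
  have hD₂ : D₂.Finite := hD.subset fun e he => he.1
  -- `D₁` and `D₂` are the edges of `F` crossing `X` before and after `P`. Thus `T \ B` isolates a
  -- stretch of `F` around `P` and `P'` inside which `F` does not cross `X`.
  set B : Set V := ⋃ e ∈ D₁, C e with hB
  set T : Set V := ⋂ e ∈ D₂, C e with hT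
  have hBcut : G.FiniteCut B := by
    have : ∀ D' : Set E, D'.Finite → D' ⊆ F → G.FiniteCut (⋃ e ∈ D', C e) := by
      intro D' hD'
      induction D', hD' using Set.Finite.induction_on with
      | empty => intro; simpa using finiteCut_empty
      | insert _ _ ih =>
        intro hs
        rw [Set.biUnion_insert]
        exact (hC _ (hs (Set.mem_insert _ _))).separates.1.union
          (ih ((Set.subset_insert _ _).trans hs))
    exact this _ hD₁ fun e he => he.1.1
  have hBP : ∀ P₀ : Ultrafilter V, (∀ e ∈ F, C e ∈ P ↔ C e ∈ P₀) → B ∉ P₀ := by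
    intro P₀ h₀ hmem
    obtain ⟨e, he, he'⟩ := (Ultrafilter.finite_biUnion_mem_iff hD₁).1 hmem
    exact he.2 ((h₀ e he.1.1).2 he')
  have hTP : ∀ P₀ : Ultrafilter V, (∀ e ∈ F, C e ∈ P ↔ C e ∈ P₀) → T ∈ P₀ := fun P₀ h₀ =>
    (Filter.biInter_mem hD₂).2 fun e he => (h₀ e he.1.1).1 he.2
  have hTtight := finite_biInter_tight hF C hC hD₂ fun e he => he.1.1
  rw [← hT] at hTtight
  have hTcut : G.FiniteCut T := by
    rcases hTtight with h | ⟨g, hg⟩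
    exacts [h ▸ finiteCut_univ, hg.separates.1]
  have hMcut := hTcut.diff hBcut
  -- an edge of `F` that leaves one of the two parts of `T \ B` leaves `T`
  have key : ∀ W : Set V, (W = X ∨ W = Xᶜ) → ∀ e ∈ F, G.Leaves e ((T \ B) ∩ W) →
      G.Leaves e T := by
    intro W hW e he hl
    refine ⟨hl.1.1.1, fun hhT => ?_⟩
    have hhB : G.head e ∉ B := by
      intro hh
      obtain ⟨f, hf, hf'⟩ := Set.mem_iUnion₂.1 hh
      exact hl.1.1.2 (Set.mem_biUnion hf ((hC f hf.1.1).tail_mem hF he hf'))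
    have hhW : G.head e ∉ W := fun hh => hl.2 ⟨⟨hhT, hhB⟩, hh⟩
    have heD : e ∈ D := by
      refine ⟨he, ?_⟩
      have h1 := hl.1.2
      rcases hW with rfl | rfl
      · exact Or.inl ⟨h1, hhW⟩
      · exact Or.inr ⟨h1, by simpa using hhW⟩
    by_cases hCe : C e ∈ P
    · exact ((hC e he).leaves hF.1).2 (Set.mem_iInter₂.1 hhT e ⟨heD, hCe⟩)
    · exact hl.1.1.2 (Set.mem_biUnion (show e ∈ D₁ from ⟨heD, hCe⟩) ((hC e he).leaves hF.1).1)
  -- Both halves of `T \ B` are left by an edge of `F`, which by `key` leaves `T`. But at most one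
  -- edge of `F` leaves `T`, and its tail cannot lie in both halves.
  have main : ∀ (P₁ P₂ : Ultrafilter V) (W : Set V), (W = X ∨ W = Xᶜ) → G.Touches F P₁ →
      G.Touches F P₂ → (∀ e ∈ F, C e ∈ P ↔ C e ∈ P₁) → (∀ e ∈ F, C e ∈ P ↔ C e ∈ P₂) →
      W ∈ P₁ → Wᶜ ∈ P₂ → (T \ B) ∩ W ∉ Q → False := by
    intro P₁ P₂ W hW h₁ h₂ hc₁ hc₂ hW₁ hW₂ hWQ
    have hWcut : G.FiniteCut W := by
      rcases hW with rfl | rfl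
      exacts [hX, hX.compl]
    have hWc : Wᶜ = X ∨ Wᶜ = Xᶜ := by
      rcases hW with rfl | rfl
      exacts [Or.inr rfl, Or.inl (compl_compl _)]
    have hM : ∀ P₀ : Ultrafilter V, (∀ e ∈ F, C e ∈ P ↔ C e ∈ P₀) → T \ B ∈ P₀ := fun P₀ h₀ =>
      Filter.inter_mem (hTP P₀ h₀) (Ultrafilter.compl_mem_iff_notMem.2 (hBP P₀ h₀))
    obtain ⟨e, he, hl⟩ := h₁.exists_leaves hF (hMcut.inter hWcut)
      (Filter.inter_mem (hM _ hc₁) hW₁) hWQ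
    have heT := key W hW e he hl
    rcases hTtight with h | ⟨g, hg⟩
    · exact heT.2 (h ▸ Set.mem_univ _)
    obtain ⟨e', he', hl'⟩ := h₂.exists_leaves hF (hMcut.inter hWcut.compl)
      (Filter.inter_mem (hM _ hc₂) hW₂)
      (fun hq => hg.separates.3 (Filter.mem_of_superset hq fun x hx => hx.1.1))
    have heT' := key _ hWc e' he' hl'
    have : e = e' := ((hg.leaves_iff e he).1 heT).trans ((hg.leaves_iff e' he').1 heT').symm
    exact hl'.1.2 (this ▸ hl.1.2)
  -- The two halves are disjoint, so one of them is not in `Q`; that one plays the role of the half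
  -- in `W`.
  by_cases hq : (T \ B) ∩ X ∈ Q
  · refine main P' P Xᶜ (Or.inr rfl) hP' hP h (fun _ _ => Iff.rfl)
      (Ultrafilter.compl_mem_iff_notMem.2 hXP') (by rwa [compl_compl]) fun hq' => ?_
    obtain ⟨x, hx, hx'⟩ := Q.nonempty_of_mem (Filter.inter_mem hq hq')
    exact hx'.2 hx.2
  · exact main P P' X (Or.inl rfl) hP hP' (fun _ _ => Iff.rfl) h hXP
      (Ultrafilter.compl_mem_iff_notMem.2 hXP') hq

end Combinatorics
-- Vertices and ends as ultrafilters on the vertex set.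
section Nodes

open Filter

variable {V : Type u} {E : Type v} {G : MultiDigraph V E}

theorem ConnectedOff.refl {S : Set V} {a : V} (ha : a ∉ S) : G.ConnectedOff S a a :=
  ⟨SimpleGraph.Walk.nil, by simpa using ha⟩

theorem ConnectedOff.of_adj {S : Set V} {a b : V} (h : G.underlying.Adj a b) (ha : a ∉ S)
    (hb : b ∉ S) : G.ConnectedOff S a b :=
  ⟨SimpleGraph.Walk.cons h SimpleGraph.Walk.nil, by simp [ha, hb]⟩

theorem ConnectedOff.left_notMem {S : Set V} {a b : V} (h : G.ConnectedOff S a b) : a ∉ S := by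
  obtain ⟨p, hp⟩ := h
  exact hp a p.start_mem_support

theorem adj_tail_head (e : E) : G.underlying.Adj (G.tail e) (G.head e) :=
  ⟨e, Or.inl ⟨rfl, rfl⟩⟩

variable (G) in
/-- The endvertices of the edges in the boundary of `X`. -/
def boundary (X : Set V) : Set V :=
  G.tail '' G.edgesBetween X Xᶜ ∪ G.head '' G.edgesBetween X Xᶜ

theorem FiniteCut.finite_boundary {X : Set V} (hX : G.FiniteCut X) : (G.boundary X).Finite :=
  (hX.image _).union (hX.image _)

/-- A walk changing sides would traverse a crossing edge and so visit the boundary. -/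
theorem ConnectedOff.mem_iff {X : Set V} {a b : V} (h : G.ConnectedOff (G.boundary X) a b) :
    a ∈ X ↔ b ∈ X := by
  obtain ⟨p, hp⟩ := h
  induction p with
  | nil => rfl
  | @cons u v w hadj p ih =>
    rw [← ih fun w hw => hp w (by simp [hw])]
    have hu : u ∉ G.boundary X := hp u (by simp)
    obtain ⟨e, ⟨rfl, rfl⟩ | ⟨rfl, rfl⟩⟩ := hadj
    all_goals
      have he : e ∉ G.edgesBetween X Xᶜ := fun he => hu (by
        first
          | exact Or.inl ⟨e, he, rfl⟩
          | exact Or.inr ⟨e, he, rfl⟩)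
      simp only [edgesBetween, Set.mem_ofPred_eq, Set.mem_compl_iff] at he
      tauto

theorem Ray.eventually_notMem (ρ : G.Ray) {S : Set V} (hS : S.Finite) :
    ∃ N, ∀ n ≥ N, ρ.vert n ∉ S := by
  obtain ⟨N, hN⟩ := G.rayEquiv_refl ρ S hS
  exact ⟨N, fun n hn => (hN n hn n hn).left_notMem⟩

variable (G) in
theorem Ends.exists_rep (ω : G.Ends) : ∃ ρ : G.Ray, ρ.toEnd = ω := Quotient.exists_rep ω

variable (G) in
/-- A ray in a given end. -/
noncomputable def Ends.ray (ω : G.Ends) : G.Ray := (Ends.exists_rep G ω).choose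

@[simp]
theorem Ends.toEnd_ray (ω : G.Ends) : (Ends.ray G ω).toEnd = ω := (Ends.exists_rep G ω).choose_spec

theorem toEnd_eq_iff {ρ ρ' : G.Ray} : ρ.toEnd = ρ'.toEnd ↔ G.RayEquiv ρ ρ' :=
  ⟨fun h => Quotient.exact h, fun h => Quotient.sound (s := G.raySetoid) h⟩

theorem mem_endComponent_iff {S : Set V} (hS : S.Finite) {ρ : G.Ray} {v : V} :
    v ∈ G.endComponent S ρ.toEnd ↔ ∃ N, ∀ n ≥ N, G.ConnectedOff S (ρ.vert n) v := by
  refine ⟨?_, fun h => ⟨ρ, rfl, h⟩⟩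
  rintro ⟨ρ', hρ', N, hN⟩
  obtain ⟨N', hN'⟩ := toEnd_eq_iff.1 hρ' S hS
  exact ⟨N', fun n hn => (hN' (max N N') (le_max_right _ _) n hn).symm.trans
    (hN _ (le_max_left _ _))⟩

theorem connectedOff_of_mem_endComponent {S : Set V} (hS : S.Finite) {ω : G.Ends} {a b : V}
    (ha : a ∈ G.endComponent S ω) (hb : b ∈ G.endComponent S ω) : G.ConnectedOff S a b := by
  rw [← Ends.toEnd_ray ω, mem_endComponent_iff hS] at ha hb
  obtain ⟨N, hN⟩ := ha
  obtain ⟨N', hN'⟩ := hb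
  exact (hN (max N N') (le_max_left _ _)).symm.trans (hN' _ (le_max_right _ _))

theorem ConnectedOff.mem_endComponent {S : Set V} {ω : G.Ends} {a b : V}
    (h : G.ConnectedOff S a b) (ha : a ∈ G.endComponent S ω) : b ∈ G.endComponent S ω := by
  obtain ⟨ρ, hρ, N, hN⟩ := ha
  exact ⟨ρ, hρ, N, fun n hn => (hN n hn).trans h⟩

theorem eventually_mem_endComponent {S : Set V} (hS : S.Finite) (ρ : G.Ray) :
    ∃ N, ∀ n ≥ N, ρ.vert n ∈ G.endComponent S ρ.toEnd := by
  obtain ⟨N, hN⟩ := G.rayEquiv_refl ρ S hS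
  exact ⟨N, fun n hn => ⟨ρ, rfl, N, fun m hm => hN m hm n hn⟩⟩

/-- The vertex ultrafilter of a point: it is principal at a vertex and at an inner point of an edge
(where it is placed at the tail), and it converges to the end at an end. -/
noncomputable def ultra : G.Space → Ultrafilter V
  | .vertex x => pure x
  | .inner e _ => pure (G.tail e)
  | .endPt ω => (hyperfilter ℕ).map (Ends.ray G ω).vert

theorem mem_ultra_vertex {X : Set V} {x : V} :
    X ∈ ultra (.vertex x : G.Space) ↔ x ∈ X := Iff.rfl

theorem frequently_of_mem_ultra {X : Set V} {ω : G.Ends}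
    (h : X ∈ ultra (.endPt ω : G.Space)) (N : ℕ) : ∃ n ≥ N, (Ends.ray G ω).vert n ∈ X := by
  have h1 : {n | (Ends.ray G ω).vert n ∈ X} ∈ hyperfilter ℕ := h
  have h2 : {n | N ≤ n} ∈ hyperfilter ℕ :=
    mem_hyperfilter_of_finite_compl ((Set.finite_lt_nat N).subset fun n hn => by simpa using hn)
  obtain ⟨n, hn, hn'⟩ := (hyperfilter ℕ).nonempty_of_mem (inter_mem h1 h2)
  exact ⟨n, hn', hn⟩

theorem mem_ultra_of_eventually {X : Set V} {ω : G.Ends} {N : ℕ}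
    (h : ∀ n ≥ N, (Ends.ray G ω).vert n ∈ X) : X ∈ ultra (.endPt ω : G.Space) := by
  refine mem_hyperfilter_of_finite_compl ((Set.finite_lt_nat N).subset fun n hn => ?_)
  by_contra hn'
  exact hn (h n (not_lt.1 hn'))

theorem endComponent_mem_ultra {S : Set V} (hS : S.Finite) (ω : G.Ends) :
    G.endComponent S ω ∈ ultra (.endPt ω : G.Space) := by
  obtain ⟨N, hN⟩ := eventually_mem_endComponent hS (Ends.ray G ω)
  rw [Ends.toEnd_ray] at hN
  exact mem_ultra_of_eventually hN

/-- A vertex of the component `C(S, ω)` lies on the same side of a cut as `ω` if `S` contains the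
boundary of the cut. -/
theorem FiniteCut.mem_iff_of_mem_endComponent {X : Set V} (hX : G.FiniteCut X) {ω : G.Ends}
    {v : V} (hv : v ∈ G.endComponent (G.boundary X) ω) :
    v ∈ X ↔ X ∈ ultra (.endPt ω : G.Space) := by
  have hC := endComponent_mem_ultra hX.finite_boundary ω
  refine ⟨fun h => mem_of_superset hC fun w hw =>
    (connectedOff_of_mem_endComponent hX.finite_boundary hv hw).mem_iff.1 h, fun h => ?_⟩
  obtain ⟨w, hw, hw'⟩ := (ultra (.endPt ω : G.Space)).nonempty_of_mem (inter_mem hC h)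
  exact (connectedOff_of_mem_endComponent hX.finite_boundary hv hw).mem_iff.2 hw'

/-- Every ray of an end eventually stays on one side of a finite cut, so the choice of ray and of
ultrafilter is immaterial. -/
theorem FiniteCut.mem_ultra_iff {X : Set V} (hX : G.FiniteCut X) {p : G.Space}
    (hp : p ∈ G.verticesAndEnds) : X ∈ ultra p ↔ p ∈ G.combClosure X := by
  obtain ⟨x, rfl⟩ | ⟨ω, rfl⟩ := hp
  · simp [mem_ultra_vertex, combClosure]
  · have : Space.endPt ω ∈ G.combClosure X ↔ ∃ ρ : G.Ray, ρ.toEnd = ω ∧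
      ∀ S : Set V, S.Finite → ∃ n, ∃ x ∈ X, G.ConnectedOff S (ρ.vert n) x := by
      simp [combClosure]
    rw [this]
    constructor
    · intro h
      refine ⟨Ends.ray G ω, Ends.toEnd_ray ω, fun S hS => ?_⟩
      obtain ⟨N, hN⟩ := (Ends.ray G ω).eventually_notMem hS
      obtain ⟨n, hn, hnX⟩ := frequently_of_mem_ultra h N
      exact ⟨n, _, hnX, ConnectedOff.refl (hN n hn)⟩
    · rintro ⟨ρ, rfl, h⟩
      obtain ⟨N, hN⟩ := eventually_mem_endComponent hX.finite_boundary ρ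
      -- Deleting the first `N` vertices of the ray as well forces `n ≥ N`.
      obtain ⟨n, x, hx, hc⟩ := h (G.boundary X ∪ ρ.vert '' Set.Iio N)
        (hX.finite_boundary.union ((Set.finite_Iio N).image _))
      have hn : N ≤ n := by
        by_contra hn
        exact hc.left_notMem (Or.inr ⟨n, not_le.1 hn, rfl⟩)
      exact (hX.mem_iff_of_mem_endComponent
        ((hc.mono Set.subset_union_left).mem_endComponent (hN n hn))).1 hx

theorem LocallyFinite.finiteCut_of_boundary_subset (hG : G.LocallyFinite) {X S : Set V}
    (hS : S.Finite) (h : ∀ e ∈ G.edgesBetween X Xᶜ, G.tail e ∈ S ∨ G.head e ∈ S) :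
    G.FiniteCut X := by
  refine (hS.biUnion fun v _ => hG v).subset fun e he => ?_
  rcases h e he with h | h
  · exact Set.mem_biUnion h (Or.inl rfl)
  · exact Set.mem_biUnion h (Or.inr rfl)

theorem LocallyFinite.finiteCut_singleton (hG : G.LocallyFinite) (x : V) : G.FiniteCut {x} :=
  hG.finiteCut_of_boundary_subset (Set.finite_singleton x) fun _ he =>
    he.imp (fun h => h.1) (fun h => h.2)

theorem LocallyFinite.finiteCut_endComponent (hG : G.LocallyFinite) {S : Set V} (hS : S.Finite)
    (ω : G.Ends) : G.FiniteCut (G.endComponent S ω) := by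
  refine hG.finiteCut_of_boundary_subset hS fun e he => ?_
  by_contra! hcon
  have h := ConnectedOff.of_adj (adj_tail_head e) hcon.1 hcon.2
  rcases he with he | he
  exacts [he.2 (h.mem_endComponent he.1), he.1 (h.symm.mem_endComponent he.2)]

/-- Distinct vertices and ends are separated by a finite cut. -/
theorem LocallyFinite.exists_separates (hG : G.LocallyFinite) {p q : G.Space}
    (hp : p ∈ G.verticesAndEnds) (hq : q ∈ G.verticesAndEnds) (hpq : p ≠ q) :
    ∃ X, G.Separates (ultra p) (ultra q) X := by
  have hv : ∀ (x : V) (q : G.Space), q ∈ G.verticesAndEnds → Space.vertex x ≠ q →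
      {x} ∉ ultra q := by
    rintro x _ (⟨y, rfl⟩ | ⟨ω, rfl⟩) hne h
    · exact hne (congrArg _ (mem_ultra_vertex.1 h).symm)
    · obtain ⟨n, -, hn⟩ := frequently_of_mem_ultra h 0
      obtain ⟨m, hm, hm'⟩ := frequently_of_mem_ultra h (n + 1)
      have := (Ends.ray G ω).injective (hn.trans hm'.symm)
      omega
  obtain ⟨x, rfl⟩ | ⟨ω, rfl⟩ := hp
  · exact ⟨{x}, hG.finiteCut_singleton x, rfl, hv x q hq hpq⟩
  obtain ⟨y, rfl⟩ | ⟨ω', rfl⟩ := hq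
  · exact ⟨{y}ᶜ, (hG.finiteCut_singleton y).compl,
      Ultrafilter.compl_mem_iff_notMem.2 (hv y _ (Or.inr ⟨ω, rfl⟩) hpq.symm), fun h => h rfl⟩
  have hne : ¬ G.RayEquiv (Ends.ray G ω) (Ends.ray G ω') := fun h => hpq <| by
    rw [← Ends.toEnd_ray ω, ← Ends.toEnd_ray ω', toEnd_eq_iff.2 h]
  -- A finite `S` separating the two ends yields the cut around `C(S, ω)`.
  simp only [RayEquiv, not_forall] at hne
  obtain ⟨S, hS, hne⟩ := hne
  refine ⟨G.endComponent S ω, hG.finiteCut_endComponent hS ω, endComponent_mem_ultra hS ω,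
    fun h => hne ?_⟩
  obtain ⟨N, hN⟩ := eventually_mem_endComponent hS (Ends.ray G ω)
  obtain ⟨N', hN'⟩ := eventually_mem_endComponent hS (Ends.ray G ω')
  obtain ⟨k, hk, hk'⟩ := frequently_of_mem_ultra h N'
  rw [Ends.toEnd_ray] at hN hN'
  exact ⟨max N N', fun m hm n hn =>
    (connectedOff_of_mem_endComponent hS (hN m (le_trans (le_max_left _ _) hm)) hk').trans
    (connectedOff_of_mem_endComponent hS (hN' k hk) (hN' n (le_trans (le_max_right _ _) hn)))⟩

end Nodes

/-! ### Cut functions and closures in `|G|`. -/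

section Topology

open Filter Topology Set

variable {V : Type u} {E : Type v} {G : MultiDigraph V E}

theorem isOpen_space_iff {U : Set G.Space} : IsOpen U ↔
    (∀ e, IsOpen {t | Space.inner e t ∈ U}) ∧
    (∀ x, Space.vertex x ∈ U → ∃ ε : ℝ, 0 < ε ∧ ∀ (e : E) (t : Set.Ioo (0 : ℝ) 1),
      (G.tail e = x → (t : ℝ) < ε → Space.inner e t ∈ U) ∧
      (G.head e = x → 1 - ε < (t : ℝ) → Space.inner e t ∈ U)) ∧
    (∀ ω, Space.endPt ω ∈ U → ∃ S : Set V, S.Finite ∧ G.endNhd S ω ⊆ U) := Iff.rfl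

theorem isOpen_edgeInterior (e : E) : IsOpen (G.edgeInterior e) := by
  refine isOpen_space_iff.2 ⟨fun f => ?_, fun x hx => ?_, fun ω hω => ?_⟩
  · by_cases h : f = e
    · subst h; simp [edgeInterior]
    · have : {t | Space.inner f t ∈ G.edgeInterior e} = ∅ := by
        ext t
        simp [edgeInterior, Ne.symm h]
      rw [this]
      exact isOpen_empty
  · simp [edgeInterior] at hx
  · simp [edgeInterior] at hω

theorem isClosed_verticesAndEnds : IsClosed G.verticesAndEnds := by
  have : G.verticesAndEnds = (⋃ e, G.edgeInterior e)ᶜ := by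
    ext p
    cases p <;> simp [verticesAndEnds, edgeInterior]
  rw [this]
  exact (isOpen_iUnion isOpen_edgeInterior).isClosed_compl

theorem vertexClosure_subset (Z : Set V) : G.vertexClosure Z ⊆ G.verticesAndEnds :=
  closure_minimal (by rintro _ ⟨x, -, rfl⟩; exact Or.inl ⟨x, rfl⟩) isClosed_verticesAndEnds

theorem mem_of_inner_mem_edgeClosure {F : Set E} {e : E} {t : Ioo (0 : ℝ) 1}
    (h : Space.inner e t ∈ G.edgeClosure F) : e ∈ F := by
  obtain ⟨p, ⟨s, rfl⟩, hp⟩ := mem_closure_iff.1 h _ (isOpen_edgeInterior e) ⟨t, rfl⟩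
  simpa [edgeInterior] using hp

theorem inner_mem_edgeClosure {F : Set E} {e : E} (he : e ∈ F) (t : Ioo (0 : ℝ) 1) :
    Space.inner e t ∈ G.edgeClosure F :=
  subset_closure (mem_biUnion he ⟨t, rfl⟩)

open Classical in
/-- The function on `|G|` that is `0` on the side `X` of a cut, `1` on the other side and linear on
every edge. -/
noncomputable def cutFun (X : Set V) : G.Space → ℝ
  | .inner e t => (1 - t) * (if G.tail e ∈ X then 0 else 1) + t * (if G.head e ∈ X then 0 else 1)
  | p => if X ∈ ultra p then 0 else 1

open Classical in
theorem cutFun_vertex (X : Set V) (x : V) :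
    cutFun X (.vertex x : G.Space) = if x ∈ X then 0 else 1 := rfl

open Classical in
theorem cutFun_inner (X : Set V) (e : E) (t : Ioo (0 : ℝ) 1) :
    cutFun X (.inner e t : G.Space) =
      (1 - t) * (if G.tail e ∈ X then 0 else 1) + t * (if G.head e ∈ X then 0 else 1) := rfl

open Classical in
theorem cutFun_of_mem {X : Set V} {p : G.Space} (hp : p ∈ G.verticesAndEnds) :
    cutFun X p = if X ∈ ultra p then 0 else 1 := by
  obtain ⟨x, rfl⟩ | ⟨ω, rfl⟩ := hp <;> rfl

theorem cutFun_eq_zero_iff {X : Set V} {p : G.Space} (hp : p ∈ G.verticesAndEnds) :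
    cutFun X p = 0 ↔ X ∈ ultra p := by
  rw [cutFun_of_mem hp]; split_ifs <;> simp_all

theorem cutFun_eq_one_iff {X : Set V} {p : G.Space} (hp : p ∈ G.verticesAndEnds) :
    cutFun X p = 1 ↔ X ∉ ultra p := by
  rw [cutFun_of_mem hp]; split_ifs <;> simp_all

theorem cutFun_inner_of_iff {X : Set V} {e : E} (h : G.tail e ∈ X ↔ G.head e ∈ X)
    (t : Ioo (0 : ℝ) 1) :
    cutFun X (.inner e t : G.Space) = cutFun X (.vertex (G.tail e) : G.Space) := by
  rw [cutFun_inner, cutFun_vertex]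
  by_cases h' : G.head e ∈ X
  · rw [if_pos h', if_pos (h.2 h')]; ring
  · rw [if_neg h', if_neg (mt h.1 h')]; ring

theorem cutFun_inner_of_leaves {X : Set V} {e : E} (h : G.Leaves e X) (t : Ioo (0 : ℝ) 1) :
    cutFun X (.inner e t : G.Space) = t := by
  rw [cutFun_inner, if_pos h.1, if_neg h.2]; ring

theorem cutFun_inner_of_enters {X : Set V} {e : E} (h : G.tail e ∉ X) (h' : G.head e ∈ X)
    (t : Ioo (0 : ℝ) 1) : cutFun X (.inner e t : G.Space) = 1 - t := by
  rw [cutFun_inner, if_neg h, if_pos h']; ring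

theorem cutFun_mem_Icc (X : Set V) (p : G.Space) : cutFun X p ∈ Icc (0 : ℝ) 1 := by
  by_cases hp : p ∈ G.verticesAndEnds
  · rw [cutFun_of_mem hp]; split_ifs <;> simp
  · cases p with
    | vertex x => exact (hp (Or.inl ⟨x, rfl⟩)).elim
    | endPt ω => exact (hp (Or.inr ⟨ω, rfl⟩)).elim
    | inner e t =>
      have := t.2.1
      have := t.2.2
      rw [cutFun_inner]
      constructor <;> split_ifs <;> linarith

/-- The slope on each edge is at most 1 in absolute value, so at a vertex one `ε` serves all edges.
At an end, deleting the finite boundary of the cut gives a basic neighbourhood on which the function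
is constant. -/
theorem FiniteCut.continuous_cutFun {X : Set V} (hX : G.FiniteCut X) :
    Continuous (cutFun X : G.Space → ℝ) := by
  refine continuous_def.2 fun U hU => isOpen_space_iff.2 ⟨fun e => ?_, fun x hx => ?_,
    fun ω hω => ?_⟩
  · have : Continuous fun t : Ioo (0 : ℝ) 1 => cutFun X (.inner e t : G.Space) := by
      simp only [cutFun_inner]
      fun_prop
    exact hU.preimage this
  · obtain ⟨ε, hε, hball⟩ := Metric.isOpen_iff.1 hU _ hx
    refine ⟨ε, hε, fun e t => ⟨?_, ?_⟩⟩
    all_goals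
      rintro rfl ht
      refine hball ?_
      have h1 := t.2.1
      have h2 := t.2.2
      rw [Metric.mem_ball, Real.dist_eq, cutFun_inner, cutFun_vertex, abs_lt]
      constructor <;> split_ifs <;> linarith
  · refine ⟨_, hX.finite_boundary, fun p hp => ?_⟩
    have hv : ∀ v ∈ G.endComponent (G.boundary X) ω,
        cutFun X (.vertex v : G.Space) = cutFun X (.endPt ω) := by
      intro v hv
      rw [cutFun_vertex, cutFun_of_mem (Or.inr ⟨ω, rfl⟩)]
      classical exact if_congr (hX.mem_iff_of_mem_endComponent hv) rfl rfl
    suffices h : cutFun X p = cutFun X (.endPt ω) by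
      rw [mem_preimage, h]
      exact hω
    cases p with
    | vertex x => exact hv x hp
    | inner e t =>
      have hb : ∀ v ∈ G.endComponent (G.boundary X) ω, v ∉ G.boundary X := fun v hv =>
        (connectedOff_of_mem_endComponent hX.finite_boundary hv hv).left_notMem
      have he : e ∉ G.edgesBetween X Xᶜ := fun he =>
        hp.elim (fun h => hb _ h (Or.inl ⟨e, he, rfl⟩)) (fun h => hb _ h (Or.inr ⟨e, he, rfl⟩))
      have hiff : G.tail e ∈ X ↔ G.head e ∈ X := by
        simp only [edgesBetween, mem_ofPred_eq, mem_compl_iff] at he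
        tauto
      rw [cutFun_inner_of_iff hiff]
      rcases hp with hp | hp
      · exact hv _ hp
      · rw [← hv _ hp, cutFun_vertex, cutFun_vertex]
        classical exact if_congr hiff rfl rfl
    | endPt ω' =>
      obtain ⟨ρ, rfl, hρ⟩ := hp
      obtain ⟨N, hN⟩ := eventually_mem_endComponent hX.finite_boundary ρ
      rw [← hv _ (hρ N), cutFun_vertex, cutFun_of_mem (Or.inr ⟨_, rfl⟩)]
      classical exact if_congr (hX.mem_iff_of_mem_endComponent (hN N le_rfl)).symm rfl rfl

/-- A vertex or end lies in the closure of an edge set if and only if the edge set touches each of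
its neighbourhoods that is bounded by a finite cut. -/
theorem LocallyFinite.mem_edgeClosure_iff (hG : G.LocallyFinite) {F : Set E} {p : G.Space}
    (hp : p ∈ G.verticesAndEnds) : p ∈ G.edgeClosure F ↔ G.Touches F (ultra p) := by
  constructor
  · intro h N hN hNp
    have hopen : IsOpen {q : G.Space | cutFun N q < 1} :=
      isOpen_lt hN.continuous_cutFun continuous_const
    obtain ⟨q, hq, hq'⟩ := mem_closure_iff.1 h _ hopen (by
      rw [mem_ofPred_eq, (cutFun_eq_zero_iff hp).2 hNp]; exact one_pos)
    obtain ⟨e, he, t, rfl⟩ := mem_iUnion₂.1 hq'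
    refine ⟨e, he, ?_⟩
    by_contra! hcon
    rw [mem_ofPred_eq, cutFun_inner, if_neg hcon.1, if_neg hcon.2] at hq
    linarith
  · intro h
    refine mem_closure_iff.2 fun U hU hpU => ?_
    obtain ⟨-, hV, hΩ⟩ := isOpen_space_iff.1 hU
    obtain ⟨x, rfl⟩ | ⟨ω, rfl⟩ := hp
    · obtain ⟨ε, hε, hball⟩ := hV x hpU
      obtain ⟨e, he, hx⟩ := h {x} (hG.finiteCut_singleton x) rfl
      -- The bound 1/2 keeps the parameter inside (0,1) when `ε` is large.
      have hm : 0 < min (ε / 2) (1 / 2) := by positivity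
      have h1 : min (ε / 2) (1 / 2) ≤ ε / 2 := min_le_left _ _
      have h2 : min (ε / 2) (1 / 2) ≤ (1 : ℝ) / 2 := min_le_right _ _
      rcases hx with hx | hx
      · exact ⟨_, (hball e ⟨min (ε / 2) (1 / 2), hm, by linarith⟩).1 hx
          (show min (ε / 2) (1 / 2) < ε by linarith), mem_biUnion he ⟨_, rfl⟩⟩
      · exact ⟨_, (hball e ⟨1 - min (ε / 2) (1 / 2), by linarith, by linarith⟩).2 hx
          (show 1 - ε < 1 - min (ε / 2) (1 / 2) by linarith), mem_biUnion he ⟨_, rfl⟩⟩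
    · obtain ⟨S, hS, hSU⟩ := hΩ ω hpU
      obtain ⟨e, he, hx⟩ := h _ (hG.finiteCut_endComponent hS ω) (endComponent_mem_ultra hS ω)
      exact ⟨.inner e ⟨1 / 2, by norm_num, by norm_num⟩, hSU hx, mem_biUnion he ⟨_, rfl⟩⟩

end Topology
-- Countability and compactness of `|G|`.
section Compactness

open Filter Topology Set

variable {V : Type u} {E : Type v} {G : MultiDigraph V E}

theorem LocallyFinite.finite_adj (hG : G.LocallyFinite) (u : V) :
    {w | G.underlying.Adj u w}.Finite := by
  refine (((hG u).image G.head).union ((hG u).image G.tail)).subset ?_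
  rintro w ⟨e, ⟨h1, h2⟩ | ⟨h1, h2⟩⟩
  · exact Or.inl ⟨e, Or.inl h1, h2⟩
  · exact Or.inr ⟨e, Or.inr h2, h1⟩

theorem WeaklyConnected.exists_adj_dist (hc : G.WeaklyConnected) {u v : V} (h : u ≠ v) :
    ∃ w, G.underlying.Adj u w ∧ G.underlying.dist u v = G.underlying.dist w v + 1 := by
  obtain ⟨p, hp⟩ := SimpleGraph.Connected.exists_walk_length_eq_dist hc u v
  cases p with
  | nil => exact (h rfl).elim
  | @cons _ w _ hadj q =>
    refine ⟨w, hadj, le_antisymm ?_ ?_⟩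
    · have h1 := SimpleGraph.Connected.dist_triangle hc (u := u) (v := w) (w := v)
      rw [SimpleGraph.dist_eq_one_iff_adj.2 hadj] at h1
      omega
    · have := SimpleGraph.dist_le q
      rw [SimpleGraph.Walk.length_cons] at hp
      omega

/-- Balls of finite radius are finite and exhaust the connected graph. Countability is needed for
the summable edge weights of the arc construction. -/
theorem LocallyFinite.countable_vertices (hG : G.LocallyFinite) (hc : G.WeaklyConnected) :
    (univ : Set V).Countable := by
  obtain ⟨o⟩ : Nonempty V := SimpleGraph.Connected.nonempty hc
  have hball : ∀ n, {v | G.underlying.dist v o ≤ n}.Finite := by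
    intro n
    induction n with
    | zero =>
      refine (finite_singleton o).subset fun v hv => ?_
      exact (SimpleGraph.Connected.dist_eq_zero_iff hc).1 (Nat.le_zero.1 hv)
    | succ n ih =>
      refine ((finite_singleton o).union (ih.biUnion fun u _ => hG.finite_adj u)).subset ?_
      intro v hv
      by_cases hvo : v = o
      · exact Or.inl hvo
      obtain ⟨w, hw, hd⟩ := hc.exists_adj_dist hvo
      refine Or.inr (mem_biUnion (?_ : G.underlying.dist w o ≤ n) hw.symm)
      have : G.underlying.dist v o ≤ n + 1 := hv
      omega
  refine (countable_iUnion fun n => (hball n).countable).mono fun v _ => ?_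
  exact mem_iUnion.2 ⟨_, le_refl (G.underlying.dist v o)⟩

theorem LocallyFinite.countable_edges (hG : G.LocallyFinite) (hc : G.WeaklyConnected) :
    Countable E := by
  refine countable_univ_iff.1 (((hG.countable_vertices hc).biUnion
    fun v _ => (hG v).countable).mono fun e _ => ?_)
  exact mem_biUnion (mem_univ (G.tail e)) (Or.inl rfl)

variable (G) in
/-- The vertices `v` such that some geodesic from `o` to `v` contains `u`. -/
def beyond (o u : V) : Set V :=
  {v | G.underlying.dist o v = G.underlying.dist o u + G.underlying.dist u v}

theorem WeaklyConnected.exists_adj_beyond (hc : G.WeaklyConnected) {o u v : V}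
    (hv : v ∈ G.beyond o u) (h : u ≠ v) : ∃ w, G.underlying.Adj u w ∧ v ∈ G.beyond o w ∧
      G.underlying.dist o w = G.underlying.dist o u + 1 ∧
      G.underlying.dist u v = G.underlying.dist w v + 1 := by
  obtain ⟨w, hw, hd⟩ := hc.exists_adj_dist h
  have h1 := SimpleGraph.Connected.dist_triangle hc (u := o) (v := w) (w := v)
  have h2 := SimpleGraph.Connected.dist_triangle hc (u := o) (v := u) (w := w)
  rw [SimpleGraph.dist_eq_one_iff_adj.2 hw] at h2
  have h3 : G.underlying.dist o v = G.underlying.dist o u + G.underlying.dist u v := hv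
  refine ⟨w, hw, ?_, ?_, hd⟩
  · show G.underlying.dist o v = _
    omega
  · omega

/-- Along a geodesic from `u` to `v` the distance from `o` only grows, so it avoids all vertices
closer to `o` than `u`. -/
theorem WeaklyConnected.connectedOff_of_beyond (hc : G.WeaklyConnected) {S : Set V} {o u v : V}
    (hv : v ∈ G.beyond o u) (hS : ∀ s ∈ S, G.underlying.dist o s < G.underlying.dist o u) :
    G.ConnectedOff S u v := by
  have hu : u ∉ S := fun h => lt_irrefl _ (hS u h)
  induction hn : G.underlying.dist u v generalizing u with
  | zero =>
    obtain rfl := (SimpleGraph.Connected.dist_eq_zero_iff hc).1 hn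
    exact ConnectedOff.refl hu
  | succ n ih =>
    have hne : u ≠ v := by
      rintro rfl
      simp at hn
    obtain ⟨w, hw, hvw, hd, hd'⟩ := hc.exists_adj_beyond hv hne
    have hS' : ∀ s ∈ S, G.underlying.dist o s < G.underlying.dist o w := fun s hs => by
      have := hS s hs
      omega
    have hwS : w ∉ S := fun h => lt_irrefl _ (hS' w h)
    exact (ConnectedOff.of_adj hw hu hwS).trans (ih hvw hS' hwS (by omega))

/-- A nonprincipal ultrafilter on the vertices converges to an end. -/
theorem LocallyFinite.exists_end (hG : G.LocallyFinite) (hc : G.WeaklyConnected)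
    {U : Ultrafilter V} (hU : ∀ x, {x} ∉ U) :
    ∃ ω : G.Ends, ∀ S : Set V, S.Finite → G.endComponent S ω ∈ U := by
  obtain ⟨o⟩ : Nonempty V := SimpleGraph.Connected.nonempty hc
  -- As in König's lemma: `beyond o u` is covered by `{u}` and finitely many `beyond o w` with `w`
  -- one step further out, and `{u} ∉ U`. Iteration yields a geodesic ray.
  have hstep : ∀ u : {u // G.beyond o u ∈ U}, ∃ w : {u // G.beyond o u ∈ U},
      G.underlying.Adj u w ∧ G.underlying.dist o w = G.underlying.dist o u + 1 := by
    rintro ⟨u, hu⟩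
    set W : Set V := {w | G.underlying.Adj u w ∧
      G.underlying.dist o w = G.underlying.dist o u + 1} with hW
    have hWfin : W.Finite := (hG.finite_adj u).subset fun w hw => hw.1
    have hsub : G.beyond o u ⊆ {u} ∪ ⋃ w ∈ W, G.beyond o w := by
      intro v hv
      by_cases h : u = v
      · exact Or.inl h.symm
      · obtain ⟨w, hw, hvw, hd, -⟩ := hc.exists_adj_beyond hv h
        exact Or.inr (mem_biUnion (show w ∈ W from ⟨hw, hd⟩) hvw)
    obtain ⟨w, hw, hw'⟩ := (Ultrafilter.finite_biUnion_mem_iff hWfin).1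
      ((Ultrafilter.union_mem_iff.1 (mem_of_superset hu hsub)).resolve_left (hU u))
    exact ⟨⟨w, hw'⟩, hw.1, hw.2⟩
  choose next hadj hdist using hstep
  have ho : G.beyond o o ∈ U := by
    have : G.beyond o o = univ := by
      ext v
      simp [beyond]
    rw [this]
    exact univ_mem
  let ρ : ℕ → {u // G.beyond o u ∈ U} := fun n => Nat.rec ⟨o, ho⟩ (fun _ u => next u) n
  have hρdist : ∀ n, G.underlying.dist o (ρ n).1 = n := by
    intro n
    induction n with
    | zero => exact SimpleGraph.dist_self
    | succ n ih => exact (hdist (ρ n)).trans (by rw [ih])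
  let ray : G.Ray :=
    { vert := fun n => (ρ n).1
      injective := fun m n h => by
        have h' : (ρ m).1 = (ρ n).1 := h
        rw [← hρdist m, ← hρdist n, h']
      adj := fun n => hadj (ρ n) }
  refine ⟨ray.toEnd, fun S hS => ?_⟩
  obtain ⟨N, hN⟩ := (hS.image (G.underlying.dist o)).bddAbove
  have hfar : ∀ n ≥ N + 1, ∀ s ∈ S, G.underlying.dist o s < G.underlying.dist o (ρ n).1 := by
    intro n hn s hs
    have := hN ⟨s, hs, rfl⟩
    rw [hρdist]
    omega
  have hbase : ∀ n ≥ N + 1, G.ConnectedOff S (ρ (N + 1)).1 (ρ n).1 := by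
    intro n hn
    induction n, hn using Nat.le_induction with
    | base => exact ConnectedOff.refl fun h => lt_irrefl _ (hfar _ le_rfl _ h)
    | succ k hk ih =>
      exact ih.trans (ConnectedOff.of_adj (hadj (ρ k)) (fun h => lt_irrefl _ (hfar _ hk _ h))
        fun h => lt_irrefl _ (hfar (k + 1) (by omega) _ h))
  refine mem_of_superset (ρ (N + 1)).2 fun v hv => ?_
  exact ⟨ray, rfl, N + 1, fun n hn =>
    (hbase n hn).symm.trans (hc.connectedOff_of_beyond hv (hfar _ le_rfl))⟩

/-- The edge parameter converges along `U` in the compact interval [0,1]; the limits 0 and 1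
correspond to the tail and the head. -/
theorem exists_le_nhds_of_edgeInterior_mem {U : Ultrafilter G.Space} {e : E}
    (h : G.edgeInterior e ∈ U) : ∃ p : G.Space, (U : Filter G.Space) ≤ 𝓝 p := by
  classical
  let g : G.Space → ℝ := fun p => match p with
    | .inner _ t => t
    | _ => 0
  have hmem : Icc (0 : ℝ) 1 ∈ U.map g := by
    refine Ultrafilter.mem_map.2 (mem_of_superset h ?_)
    rintro _ ⟨t, rfl⟩
    exact Ioo_subset_Icc_self t.2
  obtain ⟨a, ha, hle⟩ := (isCompact_iff_ultrafilter_le_nhds'.1 isCompact_Icc) (U.map g) hmem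
  have hg : Tendsto g U (𝓝 a) := hle
  have hnhd : ∀ W : Set ℝ, W ∈ 𝓝 a → ∀ O : Set G.Space,
      (∀ t : Ioo (0 : ℝ) 1, (t : ℝ) ∈ W → Space.inner e t ∈ O) → O ∈ (U : Filter G.Space) := by
    intro W hW O hO
    filter_upwards [hg hW, h] with p hp hp'
    obtain ⟨t, rfl⟩ := hp'
    exact hO t hp
  rcases eq_or_lt_of_le ha.1 with h0 | h0
  · refine ⟨.vertex (G.tail e), le_nhds_iff.2 fun O hO hOo => ?_⟩
    obtain ⟨ε, hε, hball⟩ := (isOpen_space_iff.1 hOo).2.1 _ hO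
    exact hnhd (Iio ε) (Iio_mem_nhds (h0 ▸ hε)) O fun t ht => (hball e t).1 rfl ht
  rcases eq_or_lt_of_le ha.2 with h1 | h1
  · refine ⟨.vertex (G.head e), le_nhds_iff.2 fun O hO hOo => ?_⟩
    obtain ⟨ε, hε, hball⟩ := (isOpen_space_iff.1 hOo).2.1 _ hO
    exact hnhd (Ioi (1 - ε)) (Ioi_mem_nhds (by linarith)) O fun t ht => (hball e t).2 rfl ht
  · refine ⟨.inner e ⟨a, h0, h1⟩, le_nhds_iff.2 fun O hO hOo => ?_⟩
    obtain ⟨W, hW, hWO⟩ := isOpen_induced_iff.1 ((isOpen_space_iff.1 hOo).1 e)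
    have haW : (⟨a, h0, h1⟩ : Ioo (0 : ℝ) 1) ∈ Subtype.val ⁻¹' W := hWO ▸ hO
    exact hnhd W (hW.mem_nhds haW) O fun t ht => hWO.le ht

/-- The Freudenthal compactification of a locally finite connected graph is compact. -/
theorem LocallyFinite.compactSpace (hG : G.LocallyFinite) (hc : G.WeaklyConnected) :
    CompactSpace G.Space := by
  refine isCompact_univ_iff.1 (isCompact_iff_ultrafilter_le_nhds'.2 fun U _ => ?_)
  suffices h : ∃ p : G.Space, (U : Filter G.Space) ≤ 𝓝 p by
    obtain ⟨p, hp⟩ := h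
    exact ⟨p, mem_univ p, hp⟩
  -- `U` is pushed to the vertices. If `W` is principal, `U` sits at a vertex or on one of finitely
  -- many edges; otherwise `W` determines an end, to which `U` converges.
  let W : Ultrafilter V := U.bind ultra
  have hW : ∀ X : Set V, X ∈ W ↔ {p | X ∈ ultra p} ∈ U := fun X => Iff.rfl
  by_cases hprin : ∃ x, {x} ∈ W
  · obtain ⟨x, hx⟩ := hprin
    have hsub : {p : G.Space | {x} ∈ ultra p} ⊆
        {.vertex x} ∪ ⋃ e ∈ {e | G.tail e = x ∨ G.head e = x}, G.edgeInterior e := by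
      rintro (y | ⟨e, t⟩ | ω) hp
      · exact Or.inl (congrArg _ (show y = x from hp))
      · exact Or.inr (mem_biUnion (Or.inl (show G.tail e = x from hp)) ⟨t, rfl⟩)
      · obtain ⟨n, -, hn⟩ := frequently_of_mem_ultra hp 0
        obtain ⟨m, hm, hm'⟩ := frequently_of_mem_ultra hp (n + 1)
        have := (Ends.ray G ω).injective (hn.trans hm'.symm)
        omega
    rcases Ultrafilter.union_mem_iff.1 (mem_of_superset ((hW _).1 hx) hsub) with h | h
    · refine ⟨.vertex x, le_nhds_iff.2 fun O hO _ => mem_of_superset h ?_⟩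
      simpa using hO
    · obtain ⟨e, -, he⟩ := (Ultrafilter.finite_biUnion_mem_iff (hG x)).1 h
      exact exists_le_nhds_of_edgeInterior_mem he
  · push Not at hprin
    obtain ⟨ω, hω⟩ := hG.exists_end hc hprin
    refine ⟨.endPt ω, le_nhds_iff.2 fun O hO hOo => ?_⟩
    obtain ⟨S, hS, hSO⟩ := (isOpen_space_iff.1 hOo).2.2 ω hO
    refine mem_of_superset ((hW _).1 (hω S hS)) fun p hp => hSO ?_
    cases p with
    | vertex x => exact hp
    | inner e t => exact Or.inl hp
    | endPt ω' =>
      obtain ⟨N, hN⟩ := eventually_mem_endComponent hS (Ends.ray G ω')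
      obtain ⟨n, hn, hn'⟩ := frequently_of_mem_ultra hp N
      have hall : ∀ m ≥ N, (Ends.ray G ω').vert m ∈ G.endComponent S ω := fun m hm =>
        (connectedOff_of_mem_endComponent hS (hN n hn) (hN m hm)).mem_endComponent hn'
      -- A tail of the ray, since `endNhd` demands a ray lying entirely in the component.
      let ρ : G.Ray :=
        { vert := fun k => (Ends.ray G ω').vert (N + k)
          injective := fun a b h => by
            have := (Ends.ray G ω').injective h
            omega
          adj := fun k => (Ends.ray G ω').adj (N + k) }
      refine ⟨ρ, ?_, fun k => hall _ (Nat.le_add_right _ _)⟩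
      rw [← Ends.toEnd_ray ω', toEnd_eq_iff]
      intro T hT
      obtain ⟨M, hM⟩ := G.rayEquiv_refl (Ends.ray G ω') T hT
      exact ⟨M, fun a ha b hb => hM (N + a) (by omega) b hb⟩

end Compactness
-- The arc carried by a minimal connecting set, and arcs crossing cuts.
section Arcs

open Filter Topology Set MeasureTheory

variable {V : Type u} {E : Type v} {G : MultiDigraph V E}
variable {R Q : Ultrafilter V} {F : Set E} {C : E → Set V}

theorem cutFun_tight_inner_self (hF : Minimal (G.Connects R Q) F)
    (hC : ∀ e ∈ F, G.Tight R Q F (C e) e) {e : E} (he : e ∈ F) (t : Ioo (0 : ℝ) 1) :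
    cutFun (C e) (.inner e t : G.Space) = t :=
  cutFun_inner_of_leaves ((hC e he).leaves hF.1) t

theorem cutFun_tight_inner_of_ne (hF : Minimal (G.Connects R Q) F)
    (hC : ∀ e ∈ F, G.Tight R Q F (C e) e) {e g : E} (he : e ∈ F) (hg : g ∈ F) (h : e ≠ g)
    (t : Ioo (0 : ℝ) 1) :
    cutFun (C g) (.inner e t : G.Space) = cutFun (C g) (.vertex (G.tail e) : G.Space) :=
  cutFun_inner_of_iff ((hC g hg).tail_mem_iff hF he h) t

/-- If `e` comes before `f`, every tight cut function is weakly larger on `f`: only its own edge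
gives values strictly between 0 and 1, and by `Tight.tail_mem_of_tail_mem` a tight set containing
the tail of `f` contains that of `e`. -/
theorem cutFun_tight_le (hF : Minimal (G.Connects R Q) F)
    (hC : ∀ e ∈ F, G.Tight R Q F (C e) e) {e f : E} (he : e ∈ F) (hf : f ∈ F) (hef : e ≠ f)
    (hlt : G.tail e ∈ C f) (s t : Ioo (0 : ℝ) 1) {g : E} (hg : g ∈ F) :
    cutFun (C g) (.inner e s : G.Space) ≤ cutFun (C g) (.inner f t : G.Space) := by
  by_cases hge : g = e
  · subst hge
    have := ((hC g he).tail_mem_iff_tail_notMem hF (hC f hf) hef).1 hlt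
    rw [cutFun_tight_inner_of_ne hF hC hf he hef.symm, cutFun_vertex, if_neg this]
    exact (cutFun_mem_Icc _ _).2
  by_cases hgf : g = f
  · subst hgf
    rw [cutFun_tight_inner_of_ne hF hC he hf hef, cutFun_vertex, if_pos hlt]
    exact (cutFun_mem_Icc _ _).1
  rw [cutFun_tight_inner_of_ne hF hC he hg (Ne.symm hge),
    cutFun_tight_inner_of_ne hF hC hf hg (Ne.symm hgf)]
  by_cases hfg : G.tail f ∈ C g
  · have := (hC e he).tail_mem_of_tail_mem hF (hC f hf) (hC g hg) hef hlt hfg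
    rw [cutFun_vertex, if_pos this]
    exact (cutFun_mem_Icc _ _).1
  · rw [cutFun_vertex _ (G.tail f), if_neg hfg]
    exact (cutFun_mem_Icc _ _).2

/-- The points in the closure of a minimal connecting set are linearly preordered by the cut
functions of tight sets. -/
theorem cutFun_tight_total (hF : Minimal (G.Connects R Q) F)
    (hC : ∀ e ∈ F, G.Tight R Q F (C e) e) {p q : G.Space} (hp : p ∈ G.edgeClosure F)
    (hq : q ∈ G.edgeClosure F) : (∀ g ∈ F, cutFun (C g) p ≤ cutFun (C g) q) ∨
      (∀ g ∈ F, cutFun (C g) q ≤ cutFun (C g) p) := by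
  set L : Set (G.Space × G.Space) :=
    {x | ∀ g ∈ F, cutFun (C g) x.1 ≤ cutFun (C g) x.2} ∪
    {x | ∀ g ∈ F, cutFun (C g) x.2 ≤ cutFun (C g) x.1} with hL
  -- Comparability is a closed condition on pairs, so it suffices to check it for inner points of
  -- edges in `F`.
  have hclosed : IsClosed L := by
    have hcont : ∀ g ∈ F, Continuous (cutFun (C g) : G.Space → ℝ) := fun g hg =>
      (hC g hg).separates.1.continuous_cutFun
    refine IsClosed.union ?_ ?_
    all_goals
      simp only [ofPred_forall]
      refine isClosed_biInter fun g hg => ?_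
    · exact isClosed_le ((hcont g hg).comp continuous_fst) ((hcont g hg).comp continuous_snd)
    · exact isClosed_le ((hcont g hg).comp continuous_snd) ((hcont g hg).comp continuous_fst)
  have hsub : (⋃ e ∈ F, G.edgeInterior e) ×ˢ (⋃ e ∈ F, G.edgeInterior e) ⊆ L := by
    rintro ⟨x, y⟩ ⟨hx, hy⟩
    obtain ⟨e, he, s, rfl⟩ := mem_iUnion₂.1 hx
    obtain ⟨f, hf, t, rfl⟩ := mem_iUnion₂.1 hy
    by_cases hef : e = f
    · subst hef
      have key : ∀ s t : Ioo (0 : ℝ) 1, s ≤ t → ∀ g ∈ F,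
          cutFun (C g) (.inner e s : G.Space) ≤ cutFun (C g) (.inner e t : G.Space) := by
        intro s t hst g hg
        by_cases h : e = g
        · subst h
          rw [cutFun_tight_inner_self hF hC he, cutFun_tight_inner_self hF hC he]
          exact hst
        · rw [cutFun_tight_inner_of_ne hF hC he hg h, cutFun_tight_inner_of_ne hF hC he hg h]
      exact (le_total s t).imp (key s t) (key t s)
    · by_cases hlt : G.tail e ∈ C f
      · exact Or.inl fun g hg => cutFun_tight_le hF hC he hf hef hlt s t hg
      · have hlt' : G.tail f ∈ C e := by
          by_contra h
          exact hlt (((hC e he).tail_mem_iff_tail_notMem hF (hC f hf) hef).2 h)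
        exact Or.inr fun g hg => cutFun_tight_le hF hC hf he (Ne.symm hef) hlt' t s hg
  have := closure_minimal hsub hclosed
  rw [closure_prod_eq] at this
  exact this (Set.mk_mem_prod hp hq)

/-- The cut functions of tight sets distinguish the points in the closure of a minimal connecting
set. -/
theorem LocallyFinite.eq_of_cutFun_tight_eq (hG : G.LocallyFinite)
    (hF : Minimal (G.Connects R Q) F)
    (hC : ∀ e ∈ F, G.Tight R Q F (C e) e) {p q : G.Space} (hp : p ∈ G.edgeClosure F)
    (hq : q ∈ G.edgeClosure F) (h : ∀ g ∈ F, cutFun (C g) p = cutFun (C g) q) : p = q := by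
  -- Cut functions are 0 or 1 at vertices and ends, whereas `cutFun (C e)` is the parameter itself
  -- on `e`. This settles every case except that of two vertices or ends.
  have hnode : ∀ (e : E) (t : Ioo (0 : ℝ) 1) (q : G.Space), q ∈ G.verticesAndEnds →
      cutFun (C e) q ≠ t := by
    classical
    intro e t q hq
    have h1 := t.2.1
    have h2 := t.2.2
    rw [cutFun_of_mem hq]
    split_ifs
    exacts [h1.ne, h2.ne']
  have hcases : ∀ p : G.Space, p ∈ G.verticesAndEnds ∨ ∃ e t, p = .inner e t := by
    rintro (x | ⟨e, t⟩ | ω)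
    exacts [Or.inl (Or.inl ⟨x, rfl⟩), Or.inr ⟨e, t, rfl⟩, Or.inl (Or.inr ⟨ω, rfl⟩)]
  rcases hcases p with hpn | ⟨e, s, rfl⟩ <;> rcases hcases q with hqn | ⟨f, t, rfl⟩
  · by_contra hpq
    obtain ⟨X, hX⟩ := hG.exists_separates hpn hqn hpq
    refine hX.3 (((hG.mem_edgeClosure_iff hpn).1 hp).mem_of_mem hF C hC
      ((hG.mem_edgeClosure_iff hqn).1 hq) (fun e he => ?_) hX.1 hX.2)
    rw [← cutFun_eq_zero_iff hpn, ← cutFun_eq_zero_iff hqn, h e he]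
  · have hf := mem_of_inner_mem_edgeClosure hq
    have := h f hf
    rw [cutFun_tight_inner_self hF hC hf] at this
    exact (hnode f t p hpn this).elim
  · have he := mem_of_inner_mem_edgeClosure hp
    have := h e he
    rw [cutFun_tight_inner_self hF hC he] at this
    exact (hnode e s q hqn this.symm).elim
  · have he := mem_of_inner_mem_edgeClosure hp
    have hf := mem_of_inner_mem_edgeClosure hq
    have h1 := h e he
    rw [cutFun_tight_inner_self hF hC he] at h1
    by_cases hef : e = f
    · subst hef
      rw [cutFun_tight_inner_self hF hC he] at h1
      rw [Subtype.ext h1]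
    · rw [cutFun_tight_inner_of_ne hF hC hf he (Ne.symm hef)] at h1
      exact (hnode e s _ (Or.inl ⟨_, rfl⟩) h1.symm).elim

theorem exists_pos_hasSum_one (ι : Type*) [Countable ι] [Nonempty ι] :
    ∃ w : ι → ℝ, (∀ i, 0 < w i) ∧ HasSum w 1 := by
  have := Encodable.ofCountable ι
  obtain ⟨w, hw, c, hc, -⟩ := posSumOfEncodable one_pos ι
  obtain ⟨i⟩ := ‹Nonempty ι›
  have hcpos : 0 < c := (hw i).trans_le (le_hasSum hc i fun j _ => (hw j).le)
  exact ⟨fun i => w i / c, fun i => div_pos (hw i) hcpos, by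
    simpa [hcpos.ne'] using hc.div_const c⟩

/-- A minimal set of edges connecting two distinct vertices or ends is the edge set of a directed
arc. -/
theorem isDirectedArc_edgeClosure (hG : G.LocallyFinite) (hc : G.WeaklyConnected)
    {r z : G.Space} (hr : r ∈ G.verticesAndEnds) (hz : z ∈ G.verticesAndEnds) (hrz : r ≠ z)
    (hF : Minimal (G.Connects (ultra r) (ultra z)) F) :
    G.IsDirectedArc (G.edgeClosure F) r z := by
  obtain ⟨X, hX⟩ := hG.exists_separates hr hz hrz
  have hrF : r ∈ G.edgeClosure F := (hG.mem_edgeClosure_iff hr).2 (hF.1.touches_left hX)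
  have hzF : z ∈ G.edgeClosure F := (hG.mem_edgeClosure_iff hz).2 (hF.1.touches_right hX)
  have hex : ∀ e, ∃ X, e ∈ F → G.Tight (ultra r) (ultra z) F X e := by
    intro e
    by_cases he : e ∈ F
    · obtain ⟨X, hX⟩ := exists_tight hF he
      exact ⟨X, fun _ => hX⟩
    · exact ⟨∅, fun h => (he h).elim⟩
  choose C hC using hex
  have : Nonempty F := by
    obtain ⟨e, he, -⟩ := hF.1 X hX
    exact ⟨⟨e, he⟩⟩
  have : Countable E := hG.countable_edges hc
  have : CompactSpace G.Space := hG.compactSpace hc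
  obtain ⟨w, hw, hw1⟩ := exists_pos_hasSum_one F
  have hbound : ∀ (e : F) (p : G.Space), ‖w e * cutFun (C e) p‖ ≤ w e := by
    intro e p
    have := cutFun_mem_Icc (C e) p
    rw [Real.norm_of_nonneg (mul_nonneg (hw e).le this.1)]
    exact mul_le_of_le_one_right (hw e).le this.2
  have hsum : ∀ p : G.Space, Summable fun e : F => w e * cutFun (C e) p := fun p =>
    Summable.of_norm_bounded hw1.summable fun e => hbound e p
  set τ : G.Space → ℝ := fun p => ∑' e : F, w e * cutFun (C e) p with hτ
  have hτcont : Continuous τ :=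
    continuous_tsum (fun e => continuous_const.mul (hC e e.2).separates.1.continuous_cutFun)
      hw1.summable hbound
  -- Two points of the closure are comparable in all cut functions at once; as the weights are
  -- positive, equal sums force equality in each.
  have hτinj : InjOn τ (G.edgeClosure F) := by
    have key : ∀ p q : G.Space, (∀ g ∈ F, cutFun (C g) p ≤ cutFun (C g) q) → τ p = τ q →
        ∀ g ∈ F, cutFun (C g) p = cutFun (C g) q := by
      intro p q hle heq g hg
      by_contra hne
      refine heq.not_lt (Summable.tsum_lt_tsum (i := ⟨g, hg⟩) (fun e => ?_) ?_ (hsum p) (hsum q))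
      · exact mul_le_mul_of_nonneg_left (hle e e.2) (hw e).le
      · exact mul_lt_mul_of_pos_left (lt_of_le_of_ne (hle g hg) hne) (hw _)
    intro p hp q hq heq
    rcases cutFun_tight_total hF hC hp hq with h | h
    · exact hG.eq_of_cutFun_tight_eq hF hC hp hq (key p q h heq)
    · exact (hG.eq_of_cutFun_tight_eq hF hC hq hp (key q p h heq.symm)).symm
  have hτr : τ r = 0 := by
    have : ∀ e : F, w e * cutFun (C e) r = 0 := fun e => by
      rw [(cutFun_eq_zero_iff hr).2 (hC e e.2).separates.2, mul_zero]
    simp only [hτ, this, tsum_zero]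
  have hτz : τ z = 1 := by
    have : ∀ e : F, w e * cutFun (C e) z = w e := fun e => by
      rw [(cutFun_eq_one_iff hz).2 (hC e e.2).separates.3, mul_one]
    simp only [hτ, this, hw1.tsum_eq]
  have hτIcc : ∀ p, τ p ∈ Icc (0 : ℝ) 1 := fun p =>
    ⟨tsum_nonneg fun e => mul_nonneg (hw e).le (cutFun_mem_Icc _ _).1,
      hw1.tsum_eq ▸ Summable.tsum_le_tsum (fun e => (le_abs_self _).trans (hbound e p)) (hsum p)
        hw1.summable⟩
  -- Along `e` only the summand of `e` varies, so `e` is mapped onto an interval of length `w e`.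
  have hτinner : ∀ (e : F) (t : Ioo (0 : ℝ) 1),
      τ (.inner e t) = τ (.vertex (G.tail e)) + w e * t := by
    intro e t
    rw [← sub_eq_iff_eq_add', hτ, ← (hsum _).tsum_sub (hsum _), tsum_eq_single e]
    · rw [cutFun_tight_inner_self hF hC e.2, cutFun_vertex,
        if_pos ((hC e e.2).leaves hF.1).1, mul_zero, sub_zero]
    · intro g hge
      rw [cutFun_tight_inner_of_ne hF hC e.2 g.2 fun h => hge (Subtype.ext h.symm), sub_self]
  have himage : ∀ e : F, τ '' G.edgeInterior e =
      Ioo (τ (.vertex (G.tail e))) (τ (.vertex (G.tail e)) + w e) := by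
    intro e
    ext y
    constructor
    · rintro ⟨_, ⟨t, rfl⟩, rfl⟩
      rw [hτinner]
      have h1 := mul_pos (hw e) t.2.1
      have h2 := mul_lt_mul_of_pos_left t.2.2 (hw e)
      constructor <;> linarith
    · rintro ⟨h1, h2⟩
      refine ⟨.inner e ⟨(y - τ (.vertex (G.tail e))) / w e, div_pos (by linarith) (hw e),
        (div_lt_one (hw e)).2 (by linarith)⟩, ⟨_, rfl⟩, ?_⟩
      rw [hτinner, mul_div_cancel₀ _ (hw e).ne']
      ring
  have hsub : ∀ e : F, G.edgeInterior e ⊆ G.edgeClosure F := by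
    rintro e _ ⟨t, rfl⟩
    exact inner_mem_edgeClosure e.2 t
  have hcompact : IsCompact (τ '' G.edgeClosure F) :=
    (isClosed_closure.isCompact).image hτcont
  have hvol : 1 ≤ volume (τ '' G.edgeClosure F) := by
    calc (1 : ENNReal) = ENNReal.ofReal (∑' e : F, w e) := by rw [hw1.tsum_eq, ENNReal.ofReal_one]
      _ = ∑' e : F, ENNReal.ofReal (w e) :=
        ENNReal.ofReal_tsum_of_nonneg (fun e => (hw e).le) hw1.summable
      _ = ∑' e : F, volume (τ '' G.edgeInterior e) := by
        simp only [himage, Real.volume_Ioo, add_sub_cancel_left]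
      _ = volume (⋃ e : F, τ '' G.edgeInterior e) := by
        refine (measure_iUnion (fun e f hef => ?_) fun e => ?_).symm
        · refine Set.disjoint_left.2 ?_
          rintro _ ⟨p, hp, rfl⟩ ⟨q, hq, hpq⟩
          have := hτinj (hsub f hq) (hsub e hp) hpq
          obtain ⟨s, rfl⟩ := hp
          obtain ⟨t, rfl⟩ := hq
          injection this with h _
          exact hef (Subtype.ext h.symm)
        · rw [himage]
          exact measurableSet_Ioo
      _ ≤ volume (τ '' G.edgeClosure F) :=
        measure_mono (iUnion_subset fun e => image_mono (hsub e))
  -- The image has measure at least 1, so a missed point of (0,1) would have an open set of positive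
  -- measure left over around it. The endpoints are the images of `r` and `z`.
  have hsurj : τ '' G.edgeClosure F = Icc (0 : ℝ) 1 := by
    refine Subset.antisymm (by rintro _ ⟨p, -, rfl⟩; exact hτIcc p) fun y hy => ?_
    by_contra hyn
    have hy0 : y ≠ 0 := fun h => hyn ⟨r, hrF, hτr.trans h.symm⟩
    have hy1 : y ≠ 1 := fun h => hyn ⟨z, hzF, hτz.trans h.symm⟩
    set O : Set ℝ := Ioo 0 1 ∩ (τ '' G.edgeClosure F)ᶜ with hO
    have hOopen : IsOpen O := isOpen_Ioo.inter hcompact.isClosed.isOpen_compl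
    have hOpos : 0 < volume O := hOopen.measure_pos volume
      ⟨y, ⟨lt_of_le_of_ne hy.1 hy0.symm, lt_of_le_of_ne hy.2 hy1⟩, hyn⟩
    have hle : volume (τ '' G.edgeClosure F) + volume O ≤ 1 := by
      rw [← measure_union (Set.disjoint_left.2 fun x hx hx' => hx'.2 hx) hOopen.measurableSet]
      calc volume (τ '' G.edgeClosure F ∪ O) ≤ volume (Icc (0 : ℝ) 1) := by
            refine measure_mono (union_subset ?_ (inter_subset_left.trans Ioo_subset_Icc_self))
            rintro _ ⟨p, -, rfl⟩
            exact hτIcc p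
        _ = 1 := by simp
    have hlt : (1 : ENNReal) < 1 + volume O := ENNReal.lt_add_right ENNReal.one_ne_top hOpos.ne'
    exact (hlt.trans_le ((add_le_add_left hvol _).trans hle)).false
  have : CompactSpace (G.edgeClosure F) := isCompact_iff_compactSpace.1 isClosed_closure.isCompact
  let T : G.edgeClosure F → unitInterval := fun p => ⟨τ p, hτIcc p⟩
  have hTbij : Function.Bijective T := by
    constructor
    · intro p q h
      exact Subtype.ext (hτinj p.2 q.2 (congrArg Subtype.val h))
    · intro y
      obtain ⟨p, hp, hpy⟩ := hsurj.ge y.2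
      exact ⟨⟨p, hp⟩, Subtype.ext hpy⟩
  have hTcont : Continuous (Equiv.ofBijective T hTbij) :=
    Continuous.subtype_mk (hτcont.comp continuous_subtype_val) _
  let H : G.edgeClosure F ≃ₜ unitInterval := hTcont.homeoOfEquivCompactToT2
  have hH : ∀ p : G.edgeClosure F, H p = T p := fun p => rfl
  have hτH : ∀ a : unitInterval, τ (H.symm a) = a := fun a =>
    congrArg Subtype.val ((hH _).symm.trans (H.apply_symm_apply a))
  have hHτ : ∀ (p : G.Space) (hp : p ∈ G.edgeClosure F), (H.symm (T ⟨p, hp⟩) : G.Space) = p :=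
    fun p hp => by rw [← hH, H.symm_apply_apply]
  refine ⟨fun a => H.symm a, Topology.IsEmbedding.subtypeVal.comp H.symm.isEmbedding, ?_,
    ?_, ?_, ?_⟩
  · ext p
    exact ⟨fun ⟨a, ha⟩ => ha ▸ (H.symm a).2, fun hp => ⟨_, hHτ p hp⟩⟩
  · rw [← hHτ r hrF]
    congr 2
    exact Subtype.ext hτr.symm
  · rw [← hHτ z hzF]
    congr 2
    exact Subtype.ext hτz.symm
  · rintro e ⟨_, ⟨t₀, rfl⟩, ht₀⟩ _ ⟨s, rfl⟩ _ ⟨t, rfl⟩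
    have he := mem_of_inner_mem_edgeClosure ht₀
    have hmono : s < t ↔ τ (.inner e s) < τ (.inner e t) := by
      rw [hτinner ⟨e, he⟩, hτinner ⟨e, he⟩, add_lt_add_iff_left, mul_lt_mul_iff_right₀ (hw _)]
      exact Iff.rfl
    constructor
    · rintro ⟨s', t', hs, ht, hlt⟩
      injection hs with _ hs
      injection ht with _ ht
      subst hs ht
      exact ⟨_, _, hHτ _ (inner_mem_edgeClosure he s), hHτ _ (inner_mem_edgeClosure he t),
        hmono.1 hlt⟩
    · rintro ⟨a, b, ha, hb, hab⟩
      refine ⟨s, t, rfl, rfl, hmono.2 ?_⟩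
      rw [← ha, ← hb, hτH, hτH]
      exact hab

theorem Connects.exists_directedArc (hG : G.LocallyFinite) (hc : G.WeaklyConnected)
    {r z : G.Space} (hr : r ∈ G.verticesAndEnds) (hz : z ∈ G.verticesAndEnds) (hrz : r ≠ z)
    (hF : G.Connects (ultra r) (ultra z) F) :
    ∃ A : Set G.Space, A ⊆ G.edgeClosure F ∧ G.IsDirectedArc A r z := by
  obtain ⟨F', hsub, hmin⟩ := hF.exists_minimal
  exact ⟨G.edgeClosure F', closure_mono (biUnion_subset_biUnion_left hsub),
    isDirectedArc_edgeClosure hG hc hr hz hrz hmin⟩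

/-- A directed arc that runs from one side of a finite cut to the other contains an edge that
crosses the cut in this direction. -/
theorem IsDirectedArc.exists_leaves {A : Set G.Space} {r z : G.Space}
    (hA : G.IsDirectedArc A r z) (hAF : A ⊆ G.edgeClosure F) {X : Set V} (hX : G.FiniteCut X)
    (hr : cutFun X r = 0) (hz : cutFun X z = 1) : ∃ e ∈ F, G.Leaves e X := by
  obtain ⟨σ, hσ, rfl, rfl, rfl, hdir⟩ := hA
  set f : unitInterval → ℝ := fun a => cutFun X (σ a) with hf
  have hfcont : Continuous f := hX.continuous_cutFun.comp hσ.continuous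
  -- the last point on the side of `X`
  obtain ⟨a, ha, hlast⟩ := (isClosed_singleton.preimage hfcont).isCompact.exists_isGreatest
    ⟨0, show f 0 = 0 from hr⟩
  replace ha : f a = 0 := ha
  -- The value 1/2 is not taken at vertices or ends, so `σ b` will be an inner point of a crossing
  -- edge.
  obtain ⟨b, hb, hfb⟩ := intermediate_value_Icc (unitInterval.le_one' (t := a))
    hfcont.continuousOn (show (1 / 2 : ℝ) ∈ Icc (f a) (f 1) by
      rw [ha, show f 1 = 1 from hz]; norm_num)
  have hpos : ∀ c, b ≤ c → f c ≠ 0 := by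
    intro c hbc h0
    have hca : c ≤ a := hlast h0
    have : b = a := le_antisymm (hbc.trans hca) hb.1
    rw [this, ha] at hfb
    norm_num at hfb
  have hnode : ∀ p ∈ G.verticesAndEnds, cutFun X p ≠ 1 / 2 := by
    classical
    intro p hp
    rw [cutFun_of_mem hp]
    split_ifs <;> norm_num
  obtain ⟨e, t, hbe⟩ : ∃ e t, σ b = .inner e t := by
    cases h : σ b with
    | vertex x => exact (hnode _ (Or.inl ⟨x, rfl⟩) (h ▸ hfb)).elim
    | endPt ω => exact (hnode _ (Or.inr ⟨ω, rfl⟩) (h ▸ hfb)).elim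
    | inner e t => exact ⟨e, t, rfl⟩
  have hfe : cutFun X (.inner e t : G.Space) = 1 / 2 := by rw [← hbe]; exact hfb
  have heF : e ∈ F := mem_of_inner_mem_edgeClosure (hAF ⟨b, hbe⟩)
  have hiff : ¬ (G.tail e ∈ X ↔ G.head e ∈ X) := fun h =>
    hnode _ (Or.inl ⟨_, rfl⟩) ((cutFun_inner_of_iff h t).symm.trans hfe)
  refine ⟨e, heF, ?_⟩
  by_contra hl
  have htail : G.tail e ∉ X := fun h => hl ⟨h, fun h' => hiff (iff_of_true h h')⟩
  have hhead : G.head e ∈ X := by_contra fun h => hiff (iff_of_false htail h)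
  -- From `b` on, `f` has a positive minimum `f c`.
  obtain ⟨c, hc, hmin⟩ := (isClosed_Ici (a := b)).isCompact.exists_isMinOn
    ⟨b, le_refl b⟩ hfcont.continuousOn
  have hfc : 0 < f c := lt_of_le_of_ne (cutFun_mem_Icc _ _).1 (hpos c hc).symm
  have ht1 := t.2.2
  have ht0 := t.2.1
  have hm : 0 < min (f c) (1 - (t : ℝ)) := lt_min hfc (by linarith)
  -- Chosen so that `t < s < 1` and `1 - s < f c`. If `e` entered `X`, the arc would reach parameter
  -- `s` of `e` after `b`, with the value `1 - s` below the minimum.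
  set s : ℝ := 1 - min (f c) (1 - (t : ℝ)) / 2 with hs
  have hsl : min (f c) (1 - (t : ℝ)) ≤ 1 - t := min_le_right _ _
  have hsc : min (f c) (1 - (t : ℝ)) ≤ f c := min_le_left _ _
  have hs01 : s ∈ Ioo (0 : ℝ) 1 := ⟨by linarith, by linarith⟩
  obtain ⟨b', d, hb', hd, hlt⟩ := (hdir e ⟨_, ⟨t, rfl⟩, b, hbe⟩ _ ⟨t, rfl⟩ _ ⟨⟨s, hs01⟩, rfl⟩).1
    ⟨t, ⟨s, hs01⟩, rfl, rfl, show (t : ℝ) < s by linarith⟩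
  have hbb : b' = b := hσ.injective (hb'.trans hbe.symm)
  have h1 : f c ≤ f d := hmin (show b ≤ d from hbb ▸ hlt.le)
  have h2 : f d = 1 - s := by
    rw [hf]
    simp only [hd]
    exact cutFun_inner_of_enters htail hhead _
  linarith

end Arcs
end MultiDigraph

/-! ### The equivalence. -/

open MultiDigraph in
theorem lemma5p1 {V : Type u} {E : Type v} (G : MultiDigraph V E)
    (hfin : G.LocallyFinite) (hconn : G.WeaklyConnected)
    (F : Set E) (Z : Set V) (r : G.Space) (hr : r ∈ G.verticesAndEnds)
    (hZ : ∀ z ∈ Z, MultiDigraph.Space.vertex z ≠ r) :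
    G.IsReachable r Z F ↔
      ∀ z ∈ G.vertexClosure Z, z ≠ r →
        ∃ A : Set G.Space, A ⊆ G.edgeClosure F ∧ G.IsDirectedArc A r z := by
  constructor
  · intro h z hz hzr
    have hzn := vertexClosure_subset Z hz
    refine Connects.exists_directedArc hfin hconn hr hzn hzr.symm fun X hX => ?_
    -- This neighbourhood of `z` contains a vertex of `Z`, which lies outside `X`; so reachability
    -- applies to the cut.
    have hopen : IsOpen {q : G.Space | 0 < cutFun X q} :=
      isOpen_lt continuous_const hX.1.continuous_cutFun
    obtain ⟨q, hq, x, hxZ, rfl⟩ := mem_closure_iff.1 hz _ hopen (by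
      rw [Set.mem_ofPred_eq, (cutFun_eq_one_iff hzn).2 hX.3]; exact one_pos)
    have hxX : x ∉ X := fun hx => by
      rw [Set.mem_ofPred_eq, cutFun_vertex, if_pos hx] at hq
      exact lt_irrefl _ hq
    obtain ⟨e, heF, he⟩ := h X Xᶜ isCompl_compl hX.1 ((hX.1.mem_ultra_iff hr).1 hX.2)
      ⟨x, hxX, hxZ⟩
    exact ⟨e, heF, he⟩
  · rintro h X Y hXY hXYfin hrX ⟨z, hzY, hzZ⟩
    obtain rfl : Xᶜ = Y := hXY.compl_eq
    have hX : G.FiniteCut X := hXYfin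
    -- For this direction arcs to the vertices of `Z` suffice.
    obtain ⟨A, hAF, hA⟩ := h (.vertex z) (subset_closure ⟨z, hzZ, rfl⟩) (hZ z hzZ)
    obtain ⟨e, heF, he⟩ := hA.exists_leaves hAF hX
      ((cutFun_eq_zero_iff hr).2 ((hX.mem_ultra_iff hr).2 hrX))
      ((cutFun_eq_one_iff (Or.inl ⟨z, rfl⟩)).2 hzY)
    exact ⟨e, heF, he⟩
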